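/- Let $\lambda_{C,U},\lambda_{C,D}>0$, $\lambda_C=\lambda_{C,U}+\lambda_{C,D}$, $\mu,\alpha,\beta_U,P_B,P_M>0$ and $\sigma^2\ge 0$. A typical uplink base station (BS) is located at the origin of $\mathbb{R}^2$. The other BSs and the mobile stations (MSs) form two independent homogeneous Poisson point processes on $\mathbb{R}^2$, both of density $\lambda_C$. Independently of everything else, each BS is a downlink BS with probability $\lambda_{C,D}/\lambda_C$ (otherwise an uplink BS), each MS is an uplink MS with probability $\lambda_{C,U}/\lambda_C$ (otherwise a downlink MS), and the channel from each station $i$ to the origin has an $\mathrm{Exp}(\mu)$-distributed power gain $g_i$ (Rayleigh fading; unit mean power is $\mu=1$). A station at distance $r_i$ that transmits with power $P$ is received at the origin with power $P g_i r_i^{-\alpha}$. The typical BS serves the MS nearest to it, which therefore transmits in the uplink; let $R$ be its distance. The downlink BS nearest to the origin is paired with the typical BS, and its interference is cancelled. Let $I^\psi$ be the total power received at the origin from all downlink BSs (with power $P_B$) except the paired one, and $I^\varphi$ that from all uplink MSs (with power $P_M$) except the served one; given $R=r$ these are uplink MSs beyond distance $r$. The uplink SINR is $$\gamma_U=\frac{g_U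 R^{-\alpha}P_M}{I^\psi+I^\varphi+\sigma^2},$$ where $g_U$ is the gain of the served MS. For $r>0$ put $s=s(r)=\mu\beta_U r^\alpha/P_M$. Then the success probability $P_U^C=\Pr\{\gamma_U\ge\beta_U\}$ is $$P_U^C=2\pi\lambda_C\int_0^\infty r\exp\left(-\pi\lambda_C r^2-s\sigma^2\right)\mathcal{L}_\psi(s)\,\mathcal{L}_\varphi(s)\,\mathrm{d}r,$$ where $\mathcal{L}_\psi(s)=\mathbb{E}[e^{-sI^\psi}]$ for every $r>0$ and $\mathcal{L}_\varphi(s)=\mathbb{E}[e^{-sI^\varphi}\mid R=r]$ for almost every $r>0$ are given by $$\mathcal{L}_\psi(s)=\int_0^\infty 2\pi\lambda_{C,D}\,t\,e^{-\pi\lambda_{C,D}t^2}\exp\left(-2\pi\lambda_{C,D}\int_t^\infty\frac{\beta_U\frac{P_B}{P_M}\left(\frac rx\right)^\alpha}{1+\beta_U\frac{P_B}{P_M}\left(\frac rx\right)^\alpha}\,x\,\mathrm{d}x\right)\mathrm{d}t,$$ $$\mathcal{L}_\varphi(s)=\exp\left(-2\pi\lambda_{C,U}\int_r^\infty\frac{\beta_U\left(\frac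 ry\right)^\alpha}{1+\beta_U\left(\frac ry\right)^\alpha}\,y\,\mathrm{d}y\right).$$ (If $\alpha\le 2$, the inner integrals are $+\infty$, with $e^{-\infty}=0$, and the interference is almost surely infinite, with $\gamma_U=0$.) -/

import Mathlib

open MeasureTheory ProbabilityTheory Set
open scoped ENNReal NNReal

noncomputable section

namespace CoMPflex

/-- The Euclidean plane. -/
abbrev Plane : Type := EuclideanSpace ℝ (Fin 2)

/-- `e^{-x}` for `x ∈ [0, ∞]`, with `e^{-∞} = 0`. -/
def expNeg (x : ℝ≥0∞) : ℝ≥0∞ := EReal.exp (-(x : EReal))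

/-- The Laplace transform at `s ≥ 0` of a law `ν` on `[0, ∞]`. -/
def laplace (ν : Measure ℝ≥0∞) (s : ℝ) : ℝ≥0∞ := ∫⁻ y, expNeg (ENNReal.ofReal s * y) ∂ν

section Poisson

variable {Ω : Type*} [MeasurableSpace Ω] {E : Type*} [MeasurableSpace E]

/-- The number of points of the sequence `X` that lie in `B`. -/
def count (X : ℕ → Ω → E) (B : Set E) (ω : Ω) : ℝ≥0∞ :=
  ∑' n, B.indicator (fun _ => (1 : ℝ≥0∞)) (X n ω)

/-- The random points `X 0, X 1, …` enumerate a Poisson point process with intensity measure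
`Λ`: counts are Poisson distributed, and counts in disjoint sets are independent. -/
structure IsPoissonProcess (X : ℕ → Ω → E) (Λ : Measure E) (P : Measure Ω) : Prop where
  measurable : ∀ n, Measurable (X n)
  law_count : ∀ B : Set E, MeasurableSet B → Λ B < ∞ →
    HasLaw (count X B) ((poissonMeasure (Λ B).toNNReal).map (fun k : ℕ => (k : ℝ≥0∞))) P
  indep_count : ∀ (m : ℕ) (B : Fin m → Set E), (∀ i, MeasurableSet (B i)) →
    (∀ i, Λ (B i) < ∞) → Pairwise (fun i j => Disjoint (B i) (B j)) →
    iIndepFun (fun i => count X (B i)) P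

end Poisson

/-- The parameters of the model. -/
structure Params where
  /-- density of uplink stations -/
  lamU : ℝ
  /-- density of downlink stations -/
  lamD : ℝ
  /-- rate of the exponentially distributed fading power gains -/
  μ : ℝ
  /-- path loss exponent -/
  α : ℝ
  /-- uplink SINR threshold -/
  β : ℝ
  /-- base station power -/
  PB : ℝ
  /-- mobile station power -/
  PM : ℝ
  /-- the noise power is `σ ^ 2` -/
  σ : ℝ
  lamU_pos : 0 < lamU
  lamD_pos : 0 < lamD
  μ_pos : 0 < μ
  α_pos : 0 < α
  β_pos : 0 < β
  PB_pos : 0 < PB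
  PM_pos : 0 < PM

namespace Params

variable (p : Params)

/-- The total density of base stations, which is also that of mobile stations. -/
def lamC : ℝ := p.lamU + p.lamD

/-- The probability that a station is assigned to the uplink. -/
def probU : unitInterval :=
  ⟨p.lamU / p.lamC, by
    have hU := p.lamU_pos
    have hD := p.lamD_pos
    unfold lamC
    exact ⟨by positivity, (div_le_one (by positivity)).2 (by linarith)⟩⟩

/-- The probability that a station is assigned to the downlink. -/
def probD : unitInterval := unitInterval.symm p.probU

/-- `s = μ β r^α / P_M`. -/
def s (r : ℝ) : ℝ := p.μ * p.β * r ^ p.α / p.PM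

/-- The explicit form of the Laplace transform, at `s r`, of the base station interference. -/
def lPsi (r : ℝ) : ℝ≥0∞ :=
  ∫⁻ t in Ioi (0 : ℝ),
    ENNReal.ofReal (2 * Real.pi * p.lamD * t * Real.exp (-Real.pi * p.lamD * t ^ 2)) *
      expNeg (ENNReal.ofReal (2 * Real.pi * p.lamD) * ∫⁻ x in Ioi t,
        ENNReal.ofReal ((p.β * (p.PB / p.PM) * (r / x) ^ p.α) /
          (1 + p.β * (p.PB / p.PM) * (r / x) ^ p.α) * x))

/-- The explicit form of the Laplace transform, at `s r`, of the interference of the mobile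
stations beyond distance `r`. -/
def lPhi (r : ℝ) : ℝ≥0∞ :=
  expNeg (ENNReal.ofReal (2 * Real.pi * p.lamU) * ∫⁻ y in Ioi r,
    ENNReal.ofReal ((p.β * (r / y) ^ p.α) / (1 + p.β * (r / y) ^ p.α) * y))

end Params

/-- A random field of stations. Station `n` has a position, a mark telling whether it transmits
(i.e. for a base station: is assigned to the downlink; for a mobile station: to the uplink), and
the fading power gain of its channel to the typical uplink base station, which is at `0`. -/
structure Stations (Ω : Type*) where
  pos : ℕ → Ω → Plane
  transmits : ℕ → Ω → Bool
  gain : ℕ → Ω → ℝ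

namespace Stations

variable {Ω : Type*} [MeasurableSpace Ω]

/-- The mark of station `n`: its traffic assignment and its fading. -/
def mark (S : Stations Ω) (n : ℕ) (ω : Ω) : Bool × ℝ := (S.transmits n ω, S.gain n ω)

/-- The whole field as a single random element. -/
def all (S : Stations Ω) (ω : Ω) (n : ℕ) : Plane × (Bool × ℝ) := (S.pos n ω, S.mark n ω)

/-- The positions form a homogeneous Poisson point process of density `lam`; independently of
the positions, the stations transmit independently with probability `q` each, and have
independent `Exp(μ)` fading. -/
structure IsMarkedPoisson (S : Stations Ω) (lam : ℝ) (q : unitInterval) (μ : ℝ)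
    (P : Measure Ω) : Prop where
  poisson : IsPoissonProcess S.pos (ENNReal.ofReal lam • (volume : Measure Plane)) P
  measurable_mark : ∀ n, Measurable (S.mark n)
  law_mark : ∀ n, HasLaw (S.mark n) ((bernoulliMeasure true false q).prod (expMeasure μ)) P
  indep_mark : iIndepFun S.mark P
  indep_pos_mark : IndepFun (fun ω n => S.pos n ω) (fun ω n => S.mark n ω) P

/-- The index of the station nearest to `0` among those with index in `A`. -/
def nearest (S : Stations Ω) (A : Set ℕ) (ω : Ω) : ℕ :=
  sInf {n | n ∈ A ∧ ∀ m ∈ A, ‖S.pos n ω‖ ≤ ‖S.pos m ω‖}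

/-- The power received at `0` from station `n` when the transmit power is `pw`. -/
def received (S : Stations Ω) (pw α : ℝ) (n : ℕ) (ω : Ω) : ℝ≥0∞ :=
  ENNReal.ofReal (S.gain n ω * ‖S.pos n ω‖ ^ (-α) * pw)

open scoped Classical in
/-- The total power received at `0` from all transmitting stations except station `k`. -/
def interference (S : Stations Ω) (pw α : ℝ) (k : ℕ) (ω : Ω) : ℝ≥0∞ :=
  ∑' n, if S.transmits n ω = true ∧ n ≠ k then S.received pw α n ω else 0

end Stations

/-- The network as seen from the typical uplink base station, located at `0`: the other base
stations and the mobile stations. -/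
structure Network (Ω : Type*) where
  bs : Stations Ω
  ms : Stations Ω

namespace Network

variable {Ω : Type*} [MeasurableSpace Ω]

/-- Base stations and mobile stations form independent Poisson point processes of density
`λ_C`, independently thinned into uplink and downlink ones. -/
structure IsModel (N : Network Ω) (p : Params) (P : Measure Ω) : Prop where
  bs : N.bs.IsMarkedPoisson p.lamC p.probD p.μ P
  ms : N.ms.IsMarkedPoisson p.lamC p.probU p.μ P
  indep : IndepFun N.bs.all N.ms.all P

/-- The paired base station: the nearest downlink one. -/
def paired (N : Network Ω) (ω : Ω) : ℕ := N.bs.nearest {n | N.bs.transmits n ω = true} ω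

/-- The mobile station served by the typical base station: the nearest one. -/
def served (N : Network Ω) (ω : Ω) : ℕ := N.ms.nearest univ ω

/-- The distance from the typical base station to the served mobile station. -/
def servedDist (N : Network Ω) (ω : Ω) : ℝ := ‖N.ms.pos (N.served ω) ω‖

/-- The interference from the downlink base stations; the paired one is cancelled. -/
def iPsi (N : Network Ω) (p : Params) (ω : Ω) : ℝ≥0∞ :=
  N.bs.interference p.PB p.α (N.paired ω) ω

/-- The interference from the uplink mobile stations other than the served one. -/
def iPhi (N : Network Ω) (p : Params) (ω : Ω) : ℝ≥0∞ :=
  N.ms.interference p.PM p.α (N.served ω) ω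

/-- The uplink signal to interference plus noise ratio at the typical base station. -/
def sinr (N : Network Ω) (p : Params) (ω : Ω) : ℝ≥0∞ :=
  N.ms.received p.PM p.α (N.served ω) ω /
    (N.iPsi p ω + N.iPhi p ω + ENNReal.ofReal (p.σ ^ 2))

end Network

end CoMPflex

end

/-!
The success probability of an uplink transmission is computed from the Laplace functionals of the
two Poisson fields.

*Laplace functional.* Independence of the counts gives
`E exp (-∑ f(Xₙ)) = exp (-∫ (1 - e^{-f}) dΛ)` for simple `f`, and monotone approximation gives it
for all measurable `f ≥ 0` (`IsPoissonProcess.hasPoissonLaplace`). Given the positions, i.i.d. marks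
contribute a product, so that the marked process has the same functional with intensity
`Λ.prod κ` (`HasPoissonLaplace.marking`). The marks include the uplink/downlink assignment, so
thinning needs no separate treatment.

*Nearest point.* Let `T` be the distance of the nearest point in a set `A` of marked points. The
event `a ≤ T` says that `A` has no point closer than `a`, which is itself a multiplicative
functional. Hence, on `a ≤ T < b`, the points farther than `b` keep their Laplace functional
(`HasPoissonLaplace.setLIntegral_Ico`). Letting the cells `[a, b)` of a partition shrink gives the
conditional Laplace functional, given `T`, of the points farther than `T`
(`HasPoissonLaplace.lintegral_far`), and the void probabilities give the Rayleigh law of `T`. Almost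
surely there are finitely many stations in each disk and no two at the same distance, so these
points are exactly the stations other than the nearest one. With `A` the downlink base stations this
is the formula for `lPsi`; with `A` all mobile stations it is the conditional formula for `lPhi`.
No moment of the interference is used, so path loss exponents `α ≤ 2` need no special treatment:
then the exponents are infinite and `e^{-∞} = 0`.

*Success probability.* The fading of mobile station `k` is independent of all other randomness
(`indepFun_gain`). Splitting according to the index of the served station, the exponential
tail turns the success event into `E exp (-s(R) (Iψ + Iφ + σ²))` (`measure_le_sinr`). The base
stations are independent of the mobile ones, so `Iψ` integrates to `lPsi R`, and the law of
`(R, Iφ)` gives the rest.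
-/

open MeasureTheory ProbabilityTheory Set
open scoped ENNReal NNReal

noncomputable section
namespace CoMPflex
open Filter Topology

/-! ### The function `e^{-x}` on `[0, ∞]` -/

lemma expNeg_zero : expNeg 0 = 1 := by simp [expNeg]

lemma expNeg_top : expNeg ∞ = 0 := by simp [expNeg]

lemma expNeg_add (x y : ℝ≥0∞) : expNeg (x + y) = expNeg x * expNeg y := by
  unfold expNeg
  rw [← EReal.exp_add, EReal.coe_ennreal_add, EReal.neg_add (by simp) (by simp), sub_eq_add_neg]

lemma expNeg_antitone : Antitone expNeg := fun x y h => by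
  unfold expNeg
  simpa using h

lemma expNeg_le_one (x : ℝ≥0∞) : expNeg x ≤ 1 :=
  expNeg_zero ▸ expNeg_antitone (zero_le (a := x))

lemma expNeg_ne_top (x : ℝ≥0∞) : expNeg x ≠ ∞ :=
  ne_top_of_le_ne_top ENNReal.one_ne_top (expNeg_le_one x)

lemma continuous_expNeg : Continuous expNeg :=
  ENNReal.continuous_exp.comp (continuous_neg.comp continuous_coe_ennreal_ereal)

@[fun_prop]
lemma measurable_expNeg : Measurable expNeg := continuous_expNeg.measurable

lemma expNeg_ofReal {x : ℝ} (hx : 0 ≤ x) :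
    expNeg (ENNReal.ofReal x) = ENNReal.ofReal (Real.exp (-x)) := by
  unfold expNeg
  rw [EReal.coe_ennreal_ofReal, max_eq_left hx, ← EReal.coe_neg, EReal.exp_coe]

lemma expNeg_sum {ι : Type*} (t : Finset ι) (f : ι → ℝ≥0∞) :
    expNeg (∑ i ∈ t, f i) = ∏ i ∈ t, expNeg (f i) := by
  classical
  induction t using Finset.induction_on with
  | empty => simp [expNeg_zero]
  | insert a t ha ih => rw [Finset.sum_insert ha, Finset.prod_insert ha, expNeg_add, ih]

lemma expNeg_mul_natCast (c : ℝ≥0∞) (k : ℕ) : expNeg (c * k) = expNeg c ^ k := by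
  have := expNeg_sum (Finset.range k) (fun _ => c)
  simpa [mul_comm] using this

/-- Every number in `[0, 1]` is `e^{-x}` for some `x ∈ [0, ∞]`, which depends measurably on it. -/
lemma exists_measurable_expNeg_eq :
    ∃ l : ℝ≥0∞ → ℝ≥0∞, Measurable l ∧ ∀ v ≤ 1, expNeg (l v) = v := by
  refine ⟨fun v => (-(ENNReal.log v)).toENNReal, by fun_prop, fun v hv => ?_⟩
  unfold expNeg
  rw [EReal.coe_toENNReal (by simpa using hv), neg_neg, ENNReal.exp_log]

lemma tendsto_expNeg_sum_range (f : ℕ → ℝ≥0∞) :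
    Tendsto (fun N => ∏ n ∈ Finset.range N, expNeg (f n)) atTop (𝓝 (expNeg (∑' n, f n))) := by
  simp_rw [← expNeg_sum]
  exact (continuous_expNeg.tendsto _).comp ENNReal.summable.hasSum.tendsto_sum_nat

/-! ### Laplace functional of a Poisson process -/

/-- The Laplace transform of a Poisson law. -/
lemma lintegral_expNeg_poisson (a : ℝ≥0) (c : ℝ≥0∞) :
    ∫⁻ y, expNeg (c * y) ∂((poissonMeasure a).map (fun k : ℕ => (k : ℝ≥0∞))) =
      expNeg ((1 - expNeg c) * a) := by
  rw [lintegral_map (by fun_prop) (by fun_prop), lintegral_countable']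
  simp_rw [expNeg_mul_natCast, poissonMeasure_singleton]
  obtain ⟨v, hv⟩ : ∃ v : ℝ≥0, expNeg c = v := ⟨_, (ENNReal.coe_toNNReal (expNeg_ne_top c)).symm⟩
  have hv1 : (v : ℝ) ≤ 1 := by exact_mod_cast hv ▸ expNeg_le_one c
  have h0 : (1 - expNeg c) * a = ENNReal.ofReal (((1 : ℝ) - v) * a) := by
    rw [hv, ENNReal.ofReal_mul (by linarith), ENNReal.ofReal_sub _ v.coe_nonneg]
    simp
  rw [h0, expNeg_ofReal (mul_nonneg (by linarith) a.coe_nonneg)]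
  have h1 : ∀ k : ℕ, expNeg c ^ k * ENNReal.ofReal (Real.exp (-a) * a ^ k / k.factorial) =
      ENNReal.ofReal (Real.exp (-a) * ((v * a) ^ k / k.factorial)) := fun k => by
    rw [hv, ← ENNReal.ofReal_coe_nnreal, ← ENNReal.ofReal_pow v.coe_nonneg,
      ← ENNReal.ofReal_mul (by positivity)]
    congr 1
    ring
  simp_rw [h1]
  have h2 := (NormedSpace.expSeries_div_hasSum_exp ((v : ℝ) * a)).mul_left (Real.exp (-a))
  rw [← ENNReal.ofReal_tsum_of_nonneg (fun k => by positivity) h2.summable, h2.tsum_eq,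
    ← Real.exp_eq_exp_ℝ, ← Real.exp_add]
  congr 2
  ring

section LaplaceFunctional

variable {Ω : Type*} [MeasurableSpace Ω] {E : Type*} [MeasurableSpace E]

/-- The random points `Z 0, Z 1, …` have the Laplace functional of a Poisson point process with
intensity measure `Λ`. As `f` may take the value `∞`, the functional includes the void
probabilities. -/
def HasPoissonLaplace (Z : ℕ → Ω → E) (Λ : Measure E) (P : Measure Ω) : Prop :=
  ∀ f : E → ℝ≥0∞, Measurable f →
    ∫⁻ ω, expNeg (∑' n, f (Z n ω)) ∂P = expNeg (∫⁻ z, (1 - expNeg (f z)) ∂Λ)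

lemma measurable_count {X : ℕ → Ω → E} (hX : ∀ n, Measurable (X n)) {B : Set E}
    (hB : MeasurableSet B) : Measurable (count X B) := by
  unfold count
  exact .tsum fun n => (measurable_const.indicator hB).comp (hX n)

lemma tendsto_lintegral_expNeg {P : Measure Ω} [IsFiniteMeasure P] {F : ℕ → Ω → ℝ≥0∞}
    {G : Ω → ℝ≥0∞} (hF : ∀ n, Measurable (F n))
    (h : ∀ᵐ ω ∂P, Tendsto (fun n => F n ω) atTop (𝓝 (G ω))) :
    Tendsto (fun n => ∫⁻ ω, expNeg (F n ω) ∂P) atTop (𝓝 (∫⁻ ω, expNeg (G ω) ∂P)) := by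
  refine tendsto_lintegral_of_dominated_convergence (fun _ => 1)
    (fun n => measurable_expNeg.comp (hF n)) (fun n => .of_forall fun ω => expNeg_le_one _)
    (by simp) ?_
  filter_upwards [h] with ω hω
  exact (continuous_expNeg.tendsto _).comp hω

lemma tendsto_lintegral_one_sub_expNeg {Λ : Measure E} {F : ℕ → E → ℝ≥0∞}
    {G : E → ℝ≥0∞} (hF : ∀ n, Measurable (F n)) (hm : ∀ z, Monotone fun n => F n z)
    (h : ∀ z, Tendsto (fun n => F n z) atTop (𝓝 (G z))) :
    Tendsto (fun n => ∫⁻ z, (1 - expNeg (F n z)) ∂Λ) atTop (𝓝 (∫⁻ z, (1 - expNeg (G z)) ∂Λ)) := by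
  refine lintegral_tendsto_of_tendsto_of_monotone (fun n => by fun_prop)
    (.of_forall fun z m n hmn => tsub_le_tsub_left (expNeg_antitone (hm z hmn)) _)
    (.of_forall fun z => ?_)
  exact ENNReal.Tendsto.sub tendsto_const_nhds ((continuous_expNeg.tendsto _).comp (h z))
    (.inl ENNReal.one_ne_top)

lemma tendsto_tsum_of_monotone {F : ℕ → ℕ → ℝ≥0∞} {G : ℕ → ℝ≥0∞}
    (hm : ∀ k, Monotone fun n => F n k) (h : ∀ k, Tendsto (fun n => F n k) atTop (𝓝 (G k))) :
    Tendsto (fun n => ∑' k, F n k) atTop (𝓝 (∑' k, G k)) := by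
  simp_rw [← lintegral_count]
  exact lintegral_tendsto_of_tendsto_of_monotone (fun n => .of_discrete)
    (.of_forall hm) (.of_forall h)

/-- The Laplace functional at a simple function cut off to a set `S` of finite measure. Such a
function is a combination of indicators of disjoint sets of finite measure, whose counts are
independent Poisson variables. -/
lemma IsPoissonProcess.laplace_simpleFunc {X : ℕ → Ω → E} {Λ : Measure E} {P : Measure Ω}
    [IsProbabilityMeasure P] (hX : IsPoissonProcess X Λ P) (f : SimpleFunc E ℝ≥0∞) {S : Set E}
    (hS : MeasurableSet S) (hΛ : Λ S < ∞) :
    ∫⁻ ω, expNeg (∑' n, S.indicator f (X n ω)) ∂P =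
      expNeg (∫⁻ z, (1 - expNeg (S.indicator f z)) ∂Λ) := by
  classical
  set e := f.range.equivFin
  set c : Fin f.range.card → ℝ≥0∞ := fun i => (e.symm i : ℝ≥0∞)
  set B : Fin f.range.card → Set E := fun i => f ⁻¹' {c i} ∩ S
  have hB : ∀ i, MeasurableSet (B i) := fun i => (f.measurableSet_fiber _).inter hS
  have hBΛ : ∀ i, Λ (B i) < ∞ := fun i => (measure_mono inter_subset_right).trans_lt hΛ
  have hdisj : Pairwise fun i j => Disjoint (B i) (B j) := fun i j hij => by
    refine Set.disjoint_left.2 fun z hz hz' => hij ?_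
    have : c i = c j := by rw [← hz.1, ← hz'.1]
    exact e.symm.injective (Subtype.ext this)
  -- used with `u = id` for the sum over the points and with `u = 1 - e^{-·}` for the integral
  have key : ∀ (u : ℝ≥0∞ → ℝ≥0∞) (hu : u 0 = 0) (z : E), u (S.indicator f z) =
      ∑ i, u (c i) * (B i).indicator (fun _ => (1 : ℝ≥0∞)) z := fun u hu z => by
    by_cases hz : z ∈ S
    · rw [Finset.sum_eq_single (e ⟨f z, f.mem_range_self z⟩)]
      · simp [B, c, hz]
      · intro i _ hi
        have : z ∉ B i := fun h => hi (by
          have h1 : f z = c i := h.1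
          simp [h1, c])
        simp [this]
      · simp
    · simp [B, hz, hu]
  have h1 : ∀ ω, expNeg (∑' n, S.indicator f (X n ω)) =
      ∏ i, expNeg (c i * count X (B i) ω) := fun ω => by
    rw [← expNeg_sum]
    congr 1
    simp_rw [count, ← ENNReal.tsum_mul_left]
    rw [← Summable.tsum_finsetSum (fun i _ => ENNReal.summable)]
    exact tsum_congr fun n => key id rfl _
  have h2 : (fun z => 1 - expNeg (S.indicator f z)) =
      fun z => ∑ i, (1 - expNeg (c i)) * (B i).indicator (fun _ => (1 : ℝ≥0∞)) z :=
    funext fun z => key (fun x => 1 - expNeg x) (by simp [expNeg_zero]) z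
  simp_rw [h1]
  have hind := (hX.indep_count _ B hB hBΛ hdisj).comp (fun i y => expNeg (c i * y))
    (fun i => by fun_prop)
  have h3 := lintegral_prod_eq_prod_lintegral_of_indepFun Finset.univ
    (fun i ω => expNeg (c i * count X (B i) ω)) hind
    (fun i => by have := measurable_count hX.measurable (hB i); fun_prop)
  rw [h3, h2, lintegral_finsetSum _ (fun i _ => (measurable_const.indicator (hB i)).const_mul _),
    expNeg_sum]
  refine Finset.prod_congr rfl fun i _ => ?_
  rw [lintegral_const_mul _ (measurable_const.indicator (hB i)), lintegral_indicator_const (hB i),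
    one_mul]
  have h4 := lintegral_expNeg_poisson (Λ (B i)).toNNReal (c i)
  rw [← (hX.law_count _ (hB i) (hBΛ i)).map_eq, lintegral_map (by fun_prop)
    (measurable_count hX.measurable (hB i)), ENNReal.coe_toNNReal (hBΛ i).ne] at h4
  exact h4

/-- The Laplace functional of a Poisson point process: by independence of the counts for simple
functions, and by monotone approximation in general. -/
theorem IsPoissonProcess.hasPoissonLaplace {X : ℕ → Ω → E} {Λ : Measure E} {P : Measure Ω}
    [IsProbabilityMeasure P] [SigmaFinite Λ] (hX : IsPoissonProcess X Λ P) :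
    HasPoissonLaplace X Λ P := by
  intro f hf
  set F : ℕ → E → ℝ≥0∞ := fun k => (spanningSets Λ k).indicator (SimpleFunc.eapprox f k)
  have hFm : ∀ k, Measurable (F k) := fun k =>
    (SimpleFunc.measurable _).indicator (measurableSet_spanningSets Λ k)
  have hmono : ∀ z, Monotone fun k => F k z := fun z k l hkl =>
    (indicator_le_indicator (SimpleFunc.monotone_eapprox f hkl z)).trans
      (indicator_le_indicator_of_subset (monotone_spanningSets Λ hkl) (fun _ => zero_le) z)
  have hlim : ∀ z, Tendsto (fun k => F k z) atTop (𝓝 (f z)) := fun z => by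
    refine (SimpleFunc.tendsto_eapprox hf z).congr' ?_
    filter_upwards [eventually_ge_atTop (spanningSetsIndex Λ z)] with k hk
    exact (indicator_of_mem (monotone_spanningSets Λ hk (mem_spanningSetsIndex Λ z)) _).symm
  have h1 := tendsto_lintegral_expNeg (P := P) (F := fun k ω => ∑' n, F k (X n ω))
    (G := fun ω => ∑' n, f (X n ω))
    (fun k => .tsum fun n => (hFm k).comp (hX.measurable n))
    (.of_forall fun ω => tendsto_tsum_of_monotone (fun n => hmono _) (fun n => hlim _))
  have h2 := (continuous_expNeg.tendsto _).comp
    (tendsto_lintegral_one_sub_expNeg (Λ := Λ) hFm hmono hlim)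
  refine tendsto_nhds_unique h1 (h2.congr fun k => ?_)
  exact (hX.laplace_simpleFunc _ (measurableSet_spanningSets Λ k)
    (measure_spanningSets_lt_top Λ k)).symm

end LaplaceFunctional

/-! ### Independent marking -/

section Marking

variable {Ω : Type*} [MeasurableSpace Ω] {E F : Type*} [MeasurableSpace E] [MeasurableSpace F]

/-- Independent marking: attaching i.i.d. marks with law `κ`, independent of the points, turns
intensity `Λ` into `Λ.prod κ`. Given the points, the marks contribute a product of integrals,
which is again a functional of the unmarked process. -/
theorem HasPoissonLaplace.marking {X : ℕ → Ω → E} {M : ℕ → Ω → F} {Λ : Measure E}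
    {κ : Measure F} {P : Measure Ω} [IsProbabilityMeasure P] [SFinite Λ] [IsProbabilityMeasure κ]
    (hL : HasPoissonLaplace X Λ P) (hX : ∀ n, Measurable (X n)) (hM : ∀ n, Measurable (M n))
    (hlaw : ∀ n, P.map (M n) = κ) (hind : iIndepFun M P)
    (hXM : IndepFun (fun ω n => X n ω) (fun ω n => M n ω) P) :
    HasPoissonLaplace (fun n ω => (X n ω, M n ω)) (Λ.prod κ) P := by
  intro f hf
  obtain ⟨l, hl, hl1⟩ := exists_measurable_expNeg_eq
  set h : E → ℝ≥0∞ := fun x => ∫⁻ m, expNeg (f (x, m)) ∂κ with hh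
  have hhm : Measurable h := Measurable.lintegral_prod_right' (measurable_expNeg.comp hf)
  have hh1 : ∀ x, h x ≤ 1 := fun x =>
    (lintegral_mono fun m => expNeg_le_one _).trans (by simp)
  have hXm : Measurable fun ω n => X n ω := measurable_pi_lambda _ hX
  have hMm : Measurable fun ω n => M n ω := measurable_pi_lambda _ hM
  have hΦ : Measurable fun q : (ℕ → E) × (ℕ → F) => expNeg (∑' n, f (q.1 n, q.2 n)) :=
    measurable_expNeg.comp (.tsum fun n => by fun_prop)
  have hinner : ∀ x : ℕ → E, ∫⁻ ω, expNeg (∑' n, f (x n, M n ω)) ∂P =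
      expNeg (∑' n, l (h (x n))) := fun x => by
    have h1 := tendsto_lintegral_expNeg (P := P)
      (F := fun N ω => ∑ n ∈ Finset.range N, f (x n, M n ω))
      (G := fun ω => ∑' n, f (x n, M n ω)) (fun N => by fun_prop)
      (.of_forall fun ω => ENNReal.summable.hasSum.tendsto_sum_nat)
    refine tendsto_nhds_unique h1 ((tendsto_expNeg_sum_range _).congr fun N => ?_)
    simp_rw [expNeg_sum]
    rw [lintegral_prod_eq_prod_lintegral_of_indepFun _ (fun n ω => expNeg (f (x n, M n ω)))
      (hind.comp (fun n m => expNeg (f (x n, m))) (fun n => by fun_prop))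
      (fun n => by fun_prop)]
    refine Finset.prod_congr rfl fun n _ => ?_
    rw [hl1 _ (hh1 _)]
    change ∫⁻ m, expNeg (f (x n, m)) ∂κ = _
    rw [← hlaw n, lintegral_map (by fun_prop) (hM n)]
  calc ∫⁻ ω, expNeg (∑' n, f (X n ω, M n ω)) ∂P
      = ∫⁻ q, expNeg (∑' n, f (q.1 n, q.2 n))
          ∂(P.map fun ω => ((fun n => X n ω), (fun n => M n ω))) :=
        (lintegral_map hΦ (hXm.prodMk hMm)).symm
    _ = ∫⁻ x, expNeg (∑' n, l (h (x n))) ∂(P.map fun ω n => X n ω) := by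
        rw [(indepFun_iff_map_prod_eq_prod_map_map hXm.aemeasurable hMm.aemeasurable).1 hXM,
          lintegral_prod _ hΦ.aemeasurable]
        refine lintegral_congr fun x => ?_
        rw [← hinner x]
        exact lintegral_map (hΦ.comp measurable_prodMk_left) hMm
    _ = ∫⁻ ω, expNeg (∑' n, l (h (X n ω))) ∂P :=
        lintegral_map (measurable_expNeg.comp (.tsum fun n => by fun_prop)) hXm
    _ = expNeg (∫⁻ x, (1 - expNeg (l (h x))) ∂Λ) := hL _ (hl.comp hhm)
    _ = expNeg (∫⁻ z, (1 - expNeg (f z)) ∂(Λ.prod κ)) := by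
        rw [lintegral_prod _ (by fun_prop)]
        congr 2
        funext x
        rw [hl1 _ (hh1 _), lintegral_sub (by fun_prop) ((hh1 x).trans_lt ENNReal.one_lt_top).ne
          (.of_forall fun m => expNeg_le_one _)]
        simp [hh]

end Marking

/-! ### Points beyond the nearest one -/

section Nearest

variable {Ω : Type*} [MeasurableSpace Ω] {E : Type*} [MeasurableSpace E]

/-- `T` is almost surely the infimum of `ρ` over those of the points `Z 0, Z 1, …` that lie in
`A`. -/
def IsNearestDist (Z : ℕ → Ω → E) (A : Set E) (ρ : E → ℝ) (T : Ω → ℝ) (P : Measure Ω) : Prop :=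
  ∀ᵐ ω ∂P, ∀ c, c ≤ T ω ↔ ∀ n, Z n ω ∈ A → c ≤ ρ (Z n ω)

variable {Z : ℕ → Ω → E} {Λ : Measure E} {P : Measure Ω} {A : Set E} {ρ : E → ℝ} {T : Ω → ℝ}

/-- The event `c ≤ T` is itself a multiplicative functional, with weight `0` on the points of `A`
closer than `c`. -/
lemma HasPoissonLaplace.setLIntegral_le (hL : HasPoissonLaplace Z Λ P) (hA : MeasurableSet A)
    (hρ : Measurable ρ) (hTm : Measurable T) (hT : IsNearestDist Z A ρ T P) (c : ℝ)
    {f : E → ℝ≥0∞} (hf : Measurable f) (hf0 : ∀ z ∈ A, ρ z < c → f z = 0) :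
    ∫⁻ ω in {ω | c ≤ T ω}, expNeg (∑' n, f (Z n ω)) ∂P =
      expNeg (Λ (A ∩ {z | ρ z < c})) * expNeg (∫⁻ z, (1 - expNeg (f z)) ∂Λ) := by
  set S : Set E := A ∩ {z | ρ z < c} with hS
  have hSm : MeasurableSet S := hA.inter (measurableSet_lt hρ measurable_const)
  -- adding `∞` on `S` kills the functional exactly when some point of `A` is closer than `c`
  set g : E → ℝ≥0∞ := S.indicator fun _ => ∞ with hg
  have hgm : Measurable g := measurable_const.indicator hSm
  have hsum : ∫⁻ z, (1 - expNeg (g z + f z)) ∂Λ = Λ S + ∫⁻ z, (1 - expNeg (f z)) ∂Λ := by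
    rw [← lintegral_indicator_one hSm, ← lintegral_add_left (measurable_one.indicator hSm)]
    refine lintegral_congr fun z => ?_
    by_cases hz : z ∈ S
    · simp [g, hz, hf0 z hz.1 hz.2, expNeg_top, expNeg_zero]
    · simp [g, hz]
  rw [← expNeg_add, ← hsum]
  refine Eq.trans ?_ (hL (fun z => g z + f z) (hgm.add hf))
  rw [← lintegral_indicator (measurableSet_le measurable_const hTm)]
  refine lintegral_congr_ae ?_
  filter_upwards [hT] with ω hω
  rw [ENNReal.tsum_add, expNeg_add]
  by_cases hc : c ≤ T ω
  · have h0 : ∀ n, g (Z n ω) = 0 := fun n => by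
      refine indicator_of_notMem (fun hz => ?_) _
      exact absurd ((hω c).1 hc n hz.1) (not_le.2 hz.2)
    rw [indicator_of_mem (show ω ∈ {ω | c ≤ T ω} from hc)]
    simp [h0, expNeg_zero]
  · obtain ⟨n, hn, hlt⟩ : ∃ n, Z n ω ∈ A ∧ ρ (Z n ω) < c := by
      simpa using mt (hω c).2 hc
    have htop : ∑' n, g (Z n ω) = ∞ :=
      ENNReal.tsum_eq_top_of_eq_top ⟨n, indicator_of_mem (show Z n ω ∈ S from ⟨hn, hlt⟩) _⟩
    rw [indicator_of_notMem (show ω ∉ {ω | c ≤ T ω} from hc), htop, expNeg_top, zero_mul]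

lemma HasPoissonLaplace.measure_le (hL : HasPoissonLaplace Z Λ P) (hA : MeasurableSet A)
    (hρ : Measurable ρ) (hTm : Measurable T) (hT : IsNearestDist Z A ρ T P) (c : ℝ) :
    P {ω | c ≤ T ω} = expNeg (Λ (A ∩ {z | ρ z < c})) := by
  simpa [expNeg_zero] using hL.setLIntegral_le hA hρ hTm hT c (f := fun _ => 0) measurable_const
    (fun _ _ _ => rfl)

/-- The points outside radius `b` are independent of the event `a ≤ T < b`, which is the difference
of the events `a ≤ T` and `b ≤ T`. -/
lemma HasPoissonLaplace.setLIntegral_Ico [IsProbabilityMeasure P] (hL : HasPoissonLaplace Z Λ P)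
    (hA : MeasurableSet A) (hρ : Measurable ρ) (hTm : Measurable T)
    (hT : IsNearestDist Z A ρ T P) {a b : ℝ} (hab : a ≤ b)
    {f : E → ℝ≥0∞} (hf : Measurable f) (hf0 : ∀ z ∈ A, ρ z < b → f z = 0) :
    ∫⁻ ω in {ω | a ≤ T ω ∧ T ω < b}, expNeg (∑' n, f (Z n ω)) ∂P =
      ∫⁻ _ in {ω | a ≤ T ω ∧ T ω < b}, expNeg (∫⁻ z, (1 - expNeg (f z)) ∂Λ) ∂P := by
  have hsub : {ω | b ≤ T ω} ⊆ {ω | a ≤ T ω} := fun ω h => hab.trans h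
  have hset : {ω | a ≤ T ω ∧ T ω < b} = {ω | a ≤ T ω} \ {ω | b ≤ T ω} := by
    ext ω; simp
  have hbm : MeasurableSet {ω | b ≤ T ω} := measurableSet_le measurable_const hTm
  have hle : ∀ (Y : Ω → ℝ≥0∞), (∀ ω, Y ω ≤ 1) →
      ∫⁻ ω in {ω | b ≤ T ω}, Y ω ∂P ≠ ∞ := fun Y hY => by
    refine ne_top_of_le_ne_top ENNReal.one_ne_top ?_
    exact (setLIntegral_le_lintegral _ _).trans ((lintegral_mono hY).trans (by simp))
  have hsplit : ∀ (Y : Ω → ℝ≥0∞), ∫⁻ ω in {ω | a ≤ T ω} \ {ω | b ≤ T ω}, Y ω ∂P +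
      ∫⁻ ω in {ω | b ≤ T ω}, Y ω ∂P = ∫⁻ ω in {ω | a ≤ T ω}, Y ω ∂P := fun Y => by
    rw [← lintegral_inter_add_sdiff Y {ω | a ≤ T ω} hbm, inter_eq_self_of_subset_right hsub,
      add_comm]
  have h1 := hsplit fun ω => expNeg (∑' n, f (Z n ω))
  have h2 := hsplit fun _ => expNeg (∫⁻ z, (1 - expNeg (f z)) ∂Λ)
  have ha := hL.setLIntegral_le hA hρ hTm hT a hf (fun z hz hlt => hf0 z hz (hlt.trans_le hab))
  have hb := hL.setLIntegral_le hA hρ hTm hT b hf hf0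
  rw [← hL.measure_le hA hρ hTm hT, mul_comm, ← setLIntegral_const] at ha hb
  rw [hset]
  rw [ha, hb, ← h2] at h1
  exact (ENNReal.add_left_inj (hle _ fun _ => expNeg_le_one _)).1 h1

/-- Convergence from below allows to pass to the limit without a finiteness assumption, by Fatou's
lemma. -/
lemma tendsto_lintegral_of_le_of_tendsto {Λ : Measure E} {F : ℕ → E → ℝ≥0∞} {G : E → ℝ≥0∞}
    (hF : ∀ n, Measurable (F n)) (hle : ∀ n z, F n z ≤ G z)
    (h : ∀ z, Tendsto (fun n => F n z) atTop (𝓝 (G z))) :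
    Tendsto (fun n => ∫⁻ z, F n z ∂Λ) atTop (𝓝 (∫⁻ z, G z ∂Λ)) := by
  refine tendsto_of_le_liminf_of_limsup_le ?_ ?_
  · calc ∫⁻ z, G z ∂Λ = ∫⁻ z, liminf (fun n => F n z) atTop ∂Λ :=
        lintegral_congr fun z => (h z).liminf_eq.symm
      _ ≤ _ := lintegral_liminf_le hF
  · exact limsup_le_of_le (h := .of_forall fun n => lintegral_mono (hle n))

/-- The contribution `s(t) w(z)` of a point `z`, counted only for the points of `A` farther than
`t`. -/
def farWeight (A : Set E) (ρ : E → ℝ) (s : ℝ → ℝ≥0∞) (w : E → ℝ≥0∞) (t : ℝ) : E → ℝ≥0∞ :=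
  (A ∩ {z | t < ρ z}).indicator fun z => s t * w z

lemma measurable_farWeight (hA : MeasurableSet A) (hρ : Measurable ρ) {s : ℝ → ℝ≥0∞}
    (hs : Measurable s) {w : E → ℝ≥0∞} (hw : Measurable w) :
    Measurable fun q : ℝ × E => farWeight A ρ s w q.1 q.2 := by
  have h : MeasurableSet {q : ℝ × E | q.2 ∈ A ∧ q.1 < ρ q.2} :=
    (measurable_snd hA).inter (measurableSet_lt measurable_fst (hρ.comp measurable_snd))
  exact (show Measurable fun q : ℝ × E => s q.1 * w q.2 by fun_prop).indicator h

/-- Grids starting at `c` whose mesh tends to `0`: `lo n k` is the `k`-th point of the `n`-th grid,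
and `K n t` is the index of its cell that contains `t`. -/
lemma exists_grid (c : ℝ) : ∃ (lo : ℕ → ℕ → ℝ) (K : ℕ → ℝ → ℕ), (∀ n, Measurable (K n)) ∧
    (∀ n k, c ≤ lo n k) ∧ (∀ n k, lo n k ≤ lo n (k + 1)) ∧
    (∀ n k t, (lo n k ≤ t ∧ t < lo n (k + 1)) ↔ (c ≤ t ∧ K n t = k)) ∧
    (∀ t, c ≤ t → Tendsto (fun n => lo n (K n t)) atTop (𝓝 t)) ∧
    (∀ t, c ≤ t → Tendsto (fun n => lo n (K n t + 1)) atTop (𝓝 t)) := by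
  have hclo : ∀ n k : ℕ, c ≤ c + k / ((n : ℝ) + 1) := fun n k =>
    le_add_of_nonneg_right (by positivity)
  have hlo_lim : ∀ t, c ≤ t → Tendsto
      (fun n : ℕ => c + ⌊((n : ℝ) + 1) * (t - c)⌋₊ / ((n : ℝ) + 1)) atTop (𝓝 t) := fun t ht => by
    have h1 := (tendsto_nat_floor_mul_div_atTop (R := ℝ) (sub_nonneg.2 ht)).comp
      (tendsto_natCast_atTop_atTop.atTop_add (tendsto_const_nhds (x := (1 : ℝ))))
    have h2 := h1.const_add c
    rw [add_sub_cancel] at h2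
    refine h2.congr fun n => ?_
    simp only [Function.comp_apply, mul_comm]
  refine ⟨fun n k => c + k / ((n : ℝ) + 1), fun n t => ⌊((n : ℝ) + 1) * (t - c)⌋₊,
    fun n => Nat.measurable_floor.comp (by fun_prop), hclo, fun n k => ?_, fun n k t => ?_,
    hlo_lim, fun t ht => ?_⟩
  · have : (k : ℝ) ≤ ((k + 1 : ℕ) : ℝ) := by exact_mod_cast k.le_succ
    exact add_le_add le_rfl (div_le_div_of_nonneg_right this (by positivity))
  · have hn : (0 : ℝ) < (n : ℝ) + 1 := by positivity
    have e1 : c + k / ((n : ℝ) + 1) ≤ t ↔ (k : ℝ) ≤ ((n : ℝ) + 1) * (t - c) := by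
      rw [← le_sub_iff_add_le', div_le_iff₀ hn, mul_comm]
    have e2 : t < c + (k + 1 : ℕ) / ((n : ℝ) + 1) ↔ ((n : ℝ) + 1) * (t - c) < k + 1 := by
      rw [← sub_lt_iff_lt_add', lt_div_iff₀ hn, mul_comm]
      push_cast
      rfl
    constructor
    · rintro ⟨h1, h2⟩
      have hct : c ≤ t := (hclo n k).trans h1
      exact ⟨hct, (Nat.floor_eq_iff (mul_nonneg hn.le (sub_nonneg.2 hct))).2 ⟨e1.1 h1, e2.1 h2⟩⟩
    · rintro ⟨h1, h2⟩
      have := (Nat.floor_eq_iff (mul_nonneg hn.le (sub_nonneg.2 h1))).1 h2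
      exact ⟨e1.2 this.1, e2.2 this.2⟩
  · have h2 := (hlo_lim t ht).add (tendsto_one_div_add_atTop_nhds_zero_nat (𝕜 := ℝ))
    rw [add_zero] at h2
    refine h2.congr fun n => ?_
    push_cast
    ring

/-- The approximation of `farWeight A ρ s w t` used for `t` in the cell `[a, b)`. -/
def cellWeight (A : Set E) (ρ : E → ℝ) (s : ℝ → ℝ≥0∞) (w : E → ℝ≥0∞) (a b : ℝ) : E → ℝ≥0∞ :=
  (A ∩ {z | b ≤ ρ z}).indicator fun z => s a * w z

lemma measurable_cellWeight (hA : MeasurableSet A) (hρ : Measurable ρ) {s : ℝ → ℝ≥0∞}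
    {w : E → ℝ≥0∞} (hw : Measurable w) (a b : ℝ) : Measurable (cellWeight A ρ s w a b) :=
  (hw.const_mul _).indicator (hA.inter (measurableSet_le measurable_const hρ))

lemma cellWeight_le_farWeight {E : Type*} {A : Set E} {ρ : E → ℝ} {s : ℝ → ℝ≥0∞}
    (hsm : MonotoneOn s (Ici 0)) (w : E → ℝ≥0∞)
    {a b t : ℝ} (ha : 0 ≤ a) (hat : a ≤ t) (htb : t < b) (z : E) :
    cellWeight A ρ s w a b z ≤ farWeight A ρ s w t z := by
  have hsub : A ∩ {z | b ≤ ρ z} ⊆ A ∩ {z | t < ρ z} := fun z hz => ⟨hz.1, htb.trans_le hz.2⟩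
  refine (indicator_le_indicator_of_subset hsub (fun _ => zero_le) z).trans
    (indicator_le_indicator ?_)
  gcongr
  exact hsm ha (ha.trans hat) hat

lemma tendsto_cellWeight {E : Type*} {A : Set E} {ρ : E → ℝ} {s : ℝ → ℝ≥0∞}
    (hs : Continuous s) {w : E → ℝ≥0∞} {z : E}
    (hw_top : w z ≠ ∞) {a b : ℕ → ℝ} {t : ℝ} (ha : Tendsto a atTop (𝓝 t))
    (hb : Tendsto b atTop (𝓝 t)) (htb : ∀ n, t < b n) :
    Tendsto (fun n => cellWeight A ρ s w (a n) (b n) z) atTop (𝓝 (farWeight A ρ s w t z)) := by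
  unfold cellWeight farWeight
  by_cases hz : z ∈ A ∩ {z | t < ρ z}
  · have h1 : Tendsto (fun n => s (a n) * w z) atTop (𝓝 (s t * w z)) :=
      ENNReal.Tendsto.mul_const ((hs.tendsto t).comp ha) (.inr hw_top)
    rw [indicator_of_mem hz]
    refine h1.congr' ?_
    filter_upwards [hb.eventually_lt_const hz.2] with n hn
    rw [indicator_of_mem (show z ∈ A ∩ {z | b n ≤ ρ z} from ⟨hz.1, hn.le⟩)]
  · rw [indicator_of_notMem hz]
    refine tendsto_const_nhds.congr fun n => ?_
    rw [indicator_of_notMem fun h => hz ⟨h.1, (htb n).trans_le h.2⟩]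

/-- Conditionally on the distance `T` of the nearest point of `A`, the points of `A` farther than
`T` form a Poisson process. The proof rounds `T` to the points of finer and finer grids; on each
cell of a grid the statement is `setLIntegral_Ico`. -/
theorem HasPoissonLaplace.setLIntegral_far [IsProbabilityMeasure P] (hL : HasPoissonLaplace Z Λ P)
    (hZ : ∀ n, Measurable (Z n)) (hA : MeasurableSet A) (hρ : Measurable ρ) (hTm : Measurable T)
    (hT : IsNearestDist Z A ρ T P) {s : ℝ → ℝ≥0∞} (hs : Continuous s) (hsm : MonotoneOn s (Ici 0))
    {w : E → ℝ≥0∞} (hw : Measurable w) (hw_top : ∀ z, w z ≠ ∞) {c : ℝ} (hc : 0 ≤ c) :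
    ∫⁻ ω in {ω | c ≤ T ω}, expNeg (∑' n, farWeight A ρ s w (T ω) (Z n ω)) ∂P =
      ∫⁻ ω in {ω | c ≤ T ω}, expNeg (∫⁻ z, (1 - expNeg (farWeight A ρ s w (T ω) z)) ∂Λ) ∂P := by
  obtain ⟨lo, K, hKm, hclo, hmono, hcell, hlo_lim, hhi_lim⟩ := exists_grid c
  -- `s` is evaluated at the left end of the cell and the cutoff is put at its right end, so that
  -- the approximations lie below the limit
  obtain ⟨f, hf⟩ : ∃ f : ℕ → ℕ → E → ℝ≥0∞,
    f = fun n k => cellWeight A ρ s w (lo n k) (lo n (k + 1)) := ⟨_, rfl⟩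
  have hfm : ∀ n k, Measurable (f n k) := fun n k => hf ▸ measurable_cellWeight hA hρ hw _ _
  have hdisc : ∀ (n : ℕ) (H : ℕ → Ω → ℝ≥0∞), ∫⁻ ω in {ω | c ≤ T ω}, H (K n (T ω)) ω ∂P =
      ∑' k, ∫⁻ ω in {ω | lo n k ≤ T ω ∧ T ω < lo n (k + 1)}, H k ω ∂P := fun n H => by
    have hU : {ω | c ≤ T ω} = ⋃ k, {ω | lo n k ≤ T ω ∧ T ω < lo n (k + 1)} := by
      ext ω; simp [hcell]
    have hm : ∀ k, MeasurableSet {ω | lo n k ≤ T ω ∧ T ω < lo n (k + 1)} := fun k =>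
      (measurableSet_le measurable_const hTm).inter (measurableSet_lt hTm measurable_const)
    rw [hU, lintegral_iUnion hm]
    · refine tsum_congr fun k => setLIntegral_congr_fun (hm k) fun ω hω => ?_
      rw [((hcell n k _).1 hω).2]
    · intro i j hij
      refine Set.disjoint_left.2 fun ω h1 h2 => hij ?_
      rw [← ((hcell n i _).1 h1).2, ← ((hcell n j _).1 h2).2]
  have hstep : ∀ n, ∫⁻ ω in {ω | c ≤ T ω}, expNeg (∑' m, f n (K n (T ω)) (Z m ω)) ∂P =
      ∫⁻ ω in {ω | c ≤ T ω}, expNeg (∫⁻ z, (1 - expNeg (f n (K n (T ω)) z)) ∂Λ) ∂P := fun n => by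
    rw [hdisc n fun k ω => expNeg (∑' m, f n k (Z m ω)),
      hdisc n fun k _ => expNeg (∫⁻ z, (1 - expNeg (f n k z)) ∂Λ)]
    refine tsum_congr fun k => hL.setLIntegral_Ico hA hρ hTm hT (hmono n k) (hfm n k)
      fun z _ hz => ?_
    rw [hf]
    exact indicator_of_notMem (fun h => absurd h.2 (not_le.2 hz)) _
  have hle : ∀ t, c ≤ t → ∀ n z, f n (K n t) z ≤ farWeight A ρ s w t z := fun t ht n z => by
    have hcl := (hcell n (K n t) t).2 ⟨ht, rfl⟩
    rw [hf]
    exact cellWeight_le_farWeight hsm w (hc.trans (hclo _ _)) hcl.1 hcl.2 z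
  have hlim : ∀ t, c ≤ t → ∀ z, Tendsto (fun n => f n (K n t) z) atTop
      (𝓝 (farWeight A ρ s w t z)) := fun t ht z => by
    rw [hf]
    exact tendsto_cellWeight hs (hw_top z) (hlo_lim t ht) (hhi_lim t ht)
      fun n => ((hcell n (K n t) t).2 ⟨ht, rfl⟩).2
  have hTc : ∀ᵐ ω ∂P.restrict {ω | c ≤ T ω}, c ≤ T ω :=
    ae_restrict_mem (measurableSet_le measurable_const hTm)
  have hleft := tendsto_lintegral_expNeg (P := P.restrict {ω | c ≤ T ω})
    (F := fun n ω => ∑' m, f n (K n (T ω)) (Z m ω))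
    (G := fun ω => ∑' m, farWeight A ρ s w (T ω) (Z m ω)) (fun n => .tsum fun m =>
      (measurable_from_prod_countable_right (f := fun q : ℕ × E => f n q.1 q.2) (hfm n)).comp
        (((hKm n).comp hTm).prodMk (hZ m))) (by
    filter_upwards [hTc] with ω hω
    simp_rw [← lintegral_count]
    exact tendsto_lintegral_of_le_of_tendsto (fun n => .of_discrete) (fun n m => hle _ hω n _)
      fun m => hlim _ hω _)
  have hright := tendsto_lintegral_expNeg (P := P.restrict {ω | c ≤ T ω})
    (F := fun n ω => ∫⁻ z, (1 - expNeg (f n (K n (T ω)) z)) ∂Λ)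
    (G := fun ω => ∫⁻ z, (1 - expNeg (farWeight A ρ s w (T ω) z)) ∂Λ) (fun n =>
      (Measurable.of_discrete (f := fun k => ∫⁻ z, (1 - expNeg (f n k z)) ∂Λ)).comp
        ((hKm n).comp hTm)) (by
    filter_upwards [hTc] with ω hω
    refine tendsto_lintegral_of_le_of_tendsto
      (fun n => measurable_const.sub (measurable_expNeg.comp (hfm n _)))
      (fun n z => tsub_le_tsub_left (expNeg_antitone (hle _ hω n z)) _) fun z => ?_
    exact ENNReal.Tendsto.sub tendsto_const_nhds
      ((continuous_expNeg.tendsto _).comp (hlim _ hω z)) (.inl ENNReal.one_ne_top))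
  exact tendsto_nhds_unique hleft (hright.congr fun n => (hstep n).symm)

/-- The previous theorem, tested against an arbitrary function of `T`. -/
theorem HasPoissonLaplace.lintegral_far [IsProbabilityMeasure P] [SFinite Λ]
    (hL : HasPoissonLaplace Z Λ P)
    (hZ : ∀ n, Measurable (Z n)) (hA : MeasurableSet A) (hρ : Measurable ρ) (hTm : Measurable T)
    (hT : IsNearestDist Z A ρ T P) (hT0 : ∀ ω, 0 ≤ T ω) {s : ℝ → ℝ≥0∞} (hs : Continuous s)
    (hsm : MonotoneOn s (Ici 0)) {w : E → ℝ≥0∞} (hw : Measurable w) (hw_top : ∀ z, w z ≠ ∞)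
    {φ : ℝ → ℝ≥0∞} (hφ : Measurable φ) :
    ∫⁻ ω, φ (T ω) * expNeg (∑' n, farWeight A ρ s w (T ω) (Z n ω)) ∂P =
      ∫⁻ t, φ t * expNeg (∫⁻ z, (1 - expNeg (farWeight A ρ s w t z)) ∂Λ) ∂(P.map T) := by
  have hfw := measurable_farWeight hA hρ hs.measurable hw
  have hX : Measurable fun ω => expNeg (∑' n, farWeight A ρ s w (T ω) (Z n ω)) :=
    measurable_expNeg.comp (.tsum fun n => hfw.comp (hTm.prodMk (hZ n)))
  have hG : Measurable fun t => expNeg (∫⁻ z, (1 - expNeg (farWeight A ρ s w t z)) ∂Λ) :=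
    measurable_expNeg.comp (Measurable.lintegral_prod_right'
      (f := fun q : ℝ × E => 1 - expNeg (farWeight A ρ s w q.1 q.2))
      (measurable_const.sub (measurable_expNeg.comp hfw)))
  set X := fun ω => expNeg (∑' n, farWeight A ρ s w (T ω) (Z n ω))
  set G := fun t => expNeg (∫⁻ z, (1 - expNeg (farWeight A ρ s w t z)) ∂Λ)
  have hfin : IsFiniteMeasure (P.withDensity X) := by
    refine isFiniteMeasure_withDensity (ne_top_of_le_ne_top ENNReal.one_ne_top ?_)
    exact (lintegral_mono fun ω => expNeg_le_one _).trans (by simp)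
  -- both sides are integrals of `φ` against finite measures, which agree on the sets `[c, ∞)`
  have hmeas : (P.withDensity X).map T = (P.map T).withDensity G := by
    refine Measure.ext_of_Ici _ _ fun c => ?_
    have hpre : T ⁻¹' Ici c = {ω | max c 0 ≤ T ω} := by
      ext ω; simp [hT0 ω]
    rw [Measure.map_apply hTm measurableSet_Ici, withDensity_apply _ (hTm measurableSet_Ici),
      withDensity_apply _ measurableSet_Ici, setLIntegral_map measurableSet_Ici hG hTm, hpre]
    exact hL.setLIntegral_far hZ hA hρ hTm hT hs hsm hw hw_top (le_max_right c 0)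
  calc ∫⁻ ω, φ (T ω) * X ω ∂P = ∫⁻ ω, φ (T ω) ∂(P.withDensity X) := by
        rw [lintegral_withDensity_eq_lintegral_mul _ hX
          (show Measurable fun ω => φ (T ω) from hφ.comp hTm)]
        simp [mul_comm]
    _ = ∫⁻ t, φ t ∂((P.map T).withDensity G) := by
        rw [← hmeas, lintegral_map hφ hTm]
    _ = _ := by
        rw [lintegral_withDensity_eq_lintegral_mul _ hG hφ]
        simp [G, mul_comm]

/-- If there are on average `πλc²` points of `A` closer than `c`, then the nearest one has a
Rayleigh distributed distance. -/
theorem HasPoissonLaplace.map_nearestDist [IsProbabilityMeasure P] (hL : HasPoissonLaplace Z Λ P)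
    (hA : MeasurableSet A) (hρ : Measurable ρ) (hTm : Measurable T)
    (hT : IsNearestDist Z A ρ T P) (hT0 : ∀ ω, 0 ≤ T ω) {lam : ℝ} (hlam : 0 < lam)
    (hΛ : ∀ c, 0 ≤ c → Λ (A ∩ {z | ρ z < c}) = ENNReal.ofReal (Real.pi * lam * c ^ 2)) :
    P.map T = (volume.restrict (Ioi 0)).withDensity
      fun t => ENNReal.ofReal (2 * Real.pi * lam * t * Real.exp (-Real.pi * lam * t ^ 2)) := by
  have : IsProbabilityMeasure (P.map T) := Measure.isProbabilityMeasure_map hTm.aemeasurable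
  have hpi := Real.pi_pos
  refine Measure.ext_of_Ici _ _ fun c => ?_
  have hpre : T ⁻¹' Ici c = {ω | max c 0 ≤ T ω} := by
    ext ω; simp [hT0 ω]
  have hset : (volume : Measure ℝ).restrict (Ici c ∩ Ioi 0) = volume.restrict (Ioi (max c 0)) := by
    rcases le_or_gt c 0 with h | h
    · rw [max_eq_right h, inter_eq_self_of_subset_right
        (show Ioi 0 ⊆ Ici c from fun x hx => h.trans (le_of_lt hx))]
    · rw [max_eq_left h.le, inter_eq_self_of_subset_left
        (show Ici c ⊆ Ioi 0 from fun x hx => h.trans_le hx),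
        restrict_Ioi_eq_restrict_Ici]
  have hd : ∀ t : ℝ, HasDerivAt (fun t => -Real.exp (-Real.pi * lam * t ^ 2))
      (2 * Real.pi * lam * t * Real.exp (-Real.pi * lam * t ^ 2)) t := fun t => by
    have h := (((hasDerivAt_pow 2 t).const_mul (-Real.pi * lam)).exp).neg
    convert! h using 1
    push_cast
    ring
  have hlim : Tendsto (fun t : ℝ => -Real.exp (-Real.pi * lam * t ^ 2)) atTop (𝓝 0) := by
    rw [← neg_zero]
    refine (Real.tendsto_exp_atBot.comp ?_).neg
    exact (tendsto_pow_atTop two_ne_zero).const_mul_atTop_of_neg (by nlinarith)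
  have hnn : ∀ t ∈ Ioi (max c 0),
      0 ≤ 2 * Real.pi * lam * t * Real.exp (-Real.pi * lam * t ^ 2) := fun t ht => by
    have : 0 < t := (le_max_right c 0).trans_lt ht
    positivity
  have hcont : ContinuousWithinAt (fun t => -Real.exp (-Real.pi * lam * t ^ 2))
      (Ici (max c 0)) (max c 0) := (hd _).continuousAt.continuousWithinAt
  have hint := integrableOn_Ioi_deriv_of_nonneg hcont (fun t _ => hd t) hnn hlim
  rw [Measure.map_apply hTm measurableSet_Ici, hpre, hL.measure_le hA hρ hTm hT,
    hΛ _ (le_max_right c 0), expNeg_ofReal (by positivity), withDensity_apply _ measurableSet_Ici,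
    Measure.restrict_restrict measurableSet_Ici, hset,
    ← ofReal_integral_eq_lintegral_ofReal hint (ae_restrict_of_forall_mem measurableSet_Ioi hnn),
    integral_Ioi_of_hasDerivAt_of_nonneg hcont (fun t _ => hd t) hnn hlim]
  congr 1
  simp only [neg_mul, sub_neg_eq_add, zero_add, mul_assoc]

end Nearest

/-! ### Radial integrals, exponential fading and intensities -/

/-- Integration of a radial function on the plane in polar coordinates. -/
lemma lintegral_fun_norm_plane {f : ℝ → ℝ≥0∞} (hf : Measurable f) :
    ∫⁻ x : Plane, f ‖x‖ = ENNReal.ofReal (2 * Real.pi) *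
      ∫⁻ y in Ioi (0 : ℝ), ENNReal.ofReal y * f y := by
  have hdim : Module.finrank ℝ Plane = 2 := by simp
  have hmp := (volume : Measure Plane).measurePreserving_homeomorphUnitSphereProd
  calc ∫⁻ x : Plane, f ‖x‖ = ∫⁻ x : ({(0 : Plane)}ᶜ : Set Plane), f ‖x.1‖ 
          ∂(volume.comap Subtype.val) := by
        rw [lintegral_subtype_comap (measurableSet_singleton _).compl fun x : Plane => f ‖x‖,
          restrict_compl_singleton]
    _ = ∫⁻ x, f (x.2 : ℝ) ∂((volume : Measure Plane).toSphere.prod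
          (.volumeIoiPow (Module.finrank ℝ Plane - 1))) := by
        simpa using hmp.lintegral_comp_emb (Homeomorph.measurableEmbedding _)
          (f ∘ Subtype.val ∘ Prod.snd)
    _ = (volume : Measure Plane).toSphere univ *
          ∫⁻ y : Ioi (0 : ℝ), f y ∂(.volumeIoiPow (Module.finrank ℝ Plane - 1)) := by
        rw [lintegral_prod _ (by fun_prop)]
        dsimp only
        rw [lintegral_const, mul_comm]
    _ = _ := by
        rw [Measure.toSphere_apply_univ, hdim, EuclideanSpace.volume_ball_fin_two,
          Measure.volumeIoiPow, lintegral_withDensity_eq_lintegral_mul _ (by fun_prop)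
            (by fun_prop)]
        congr 1
        · rw [ENNReal.ofReal_mul zero_le_two]
          simp
        · simp only [Nat.add_one_sub_one, pow_one, Pi.mul_apply]
          exact lintegral_subtype_comap measurableSet_Ioi fun y : ℝ => ENNReal.ofReal y * f y

lemma volume_norm_lt_plane {c : ℝ} (hc : 0 ≤ c) :
    volume {x : Plane | ‖x‖ < c} = ENNReal.ofReal (Real.pi * c ^ 2) := by
  have : {x : Plane | ‖x‖ < c} = Metric.ball 0 c := by ext x; simp
  rw [this, EuclideanSpace.volume_ball_fin_two, mul_comm, ENNReal.ofReal_mul Real.pi_pos.le,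
    ENNReal.ofReal_pow hc]

section Exponential

variable {μ : ℝ}

/-- The Laplace transform of the exponential law. -/
lemma lintegral_expNeg_expMeasure (hμ : 0 < μ) {a : ℝ} (ha : 0 ≤ a) :
    ∫⁻ y, expNeg (ENNReal.ofReal (y * a)) ∂(expMeasure μ) = ENNReal.ofReal (μ / (μ + a)) := by
  have hm : Measurable (exponentialPDF μ) := (measurable_exponentialPDFReal μ).ennreal_ofReal
  change ∫⁻ y, expNeg (ENNReal.ofReal (y * a)) ∂(volume.withDensity (exponentialPDF μ)) = _
  rw [lintegral_withDensity_eq_lintegral_mul _ hm (by fun_prop)]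
  -- tilting the density of rate `μ` gives a multiple of the density of rate `μ + a`
  have h1 : ∀ y, exponentialPDF μ y * expNeg (ENNReal.ofReal (y * a)) =
      ENNReal.ofReal (μ / (μ + a)) * exponentialPDF (μ + a) y := fun y => by
    rcases lt_or_ge y 0 with hy | hy
    · simp [exponentialPDF_of_neg hy]
    · rw [exponentialPDF_of_nonneg hy, exponentialPDF_of_nonneg hy, expNeg_ofReal (by positivity),
        ← ENNReal.ofReal_mul (by positivity), ← ENNReal.ofReal_mul (by positivity)]
      congr 1
      rw [mul_assoc, ← Real.exp_add]
      field_simp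
      ring_nf
  simp only [Pi.mul_apply, h1]
  have hm' : Measurable (exponentialPDF (μ + a)) :=
    (measurable_exponentialPDFReal _).ennreal_ofReal
  rw [lintegral_const_mul _ hm', lintegral_exponentialPDF_eq_one (by positivity), mul_one]

lemma lintegral_one_sub_expNeg_expMeasure (hμ : 0 < μ) {a : ℝ} (ha : 0 ≤ a) :
    ∫⁻ y, (1 - expNeg (ENNReal.ofReal (y * a))) ∂(expMeasure μ) =
      ENNReal.ofReal (a / μ / (1 + a / μ)) := by
  have := isProbabilityMeasure_expMeasure hμ
  have hL := lintegral_expNeg_expMeasure hμ ha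
  rw [lintegral_sub (by fun_prop) (by rw [hL]; exact ENNReal.ofReal_ne_top)
    (.of_forall fun y => expNeg_le_one _), hL, lintegral_const, measure_univ, one_mul,
    ← ENNReal.ofReal_one, ← ENNReal.ofReal_sub _ (by positivity)]
  congr 1
  field_simp
  ring

/-- The tail of the exponential law. -/
lemma expMeasure_le_ofReal (hμ : 0 < μ) (c : ℝ≥0∞) :
    expMeasure μ {y | c ≤ ENNReal.ofReal y} = expNeg (ENNReal.ofReal μ * c) := by
  have := isProbabilityMeasure_expMeasure hμ
  have : NullSingletonClass (expMeasure μ) :=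
    inferInstanceAs (NullSingletonClass ((volume : Measure ℝ).withDensity (exponentialPDF μ)))
  induction c using ENNReal.recTopCoe with
  | top => simp [ENNReal.mul_top, hμ, expNeg_top]
  | coe x =>
    rcases eq_or_ne x 0 with rfl | hx
    · simp [expNeg_zero]
    have hx0 : (0 : ℝ) < x := by
      have := pos_iff_ne_zero.2 hx
      exact_mod_cast this
    have hset : {y : ℝ | (x : ℝ≥0∞) ≤ ENNReal.ofReal y} = Ici (x : ℝ) := by
      ext y
      rw [mem_ofPred_eq, ← ENNReal.ofReal_coe_nnreal, ENNReal.ofReal_le_ofReal_iff']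
      simp [hx0.not_ge]
    have hcdf := cdf_expMeasure_eq hμ (x : ℝ)
    rw [cdf_eq_real, if_pos hx0.le] at hcdf
    rw [hset, ← measure_congr Ioi_ae_eq_Ici, ← ofReal_measureReal, ← compl_Iic,
      probReal_compl_eq_one_sub measurableSet_Iic, hcdf, ← ENNReal.ofReal_coe_nnreal,
      ← ENNReal.ofReal_mul hμ.le, expNeg_ofReal (by positivity), sub_sub_cancel]

end Exponential

/-- The law of the mark of a station. -/
def markLaw (q : unitInterval) (μ : ℝ) : Measure (Bool × ℝ) :=
  (bernoulliMeasure true false q).prod (expMeasure μ)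

/-- The intensity measure of a marked field of stations, on pairs of a position and a mark. -/
def stationIntensity (lam : ℝ) (q : unitInterval) (μ : ℝ) : Measure (Plane × (Bool × ℝ)) :=
  (ENNReal.ofReal lam • (volume : Measure Plane)).prod (markLaw q μ)

lemma isProbabilityMeasure_markLaw (q : unitInterval) {μ : ℝ} (hμ : 0 < μ) :
    IsProbabilityMeasure (markLaw q μ) := by
  have := isProbabilityMeasure_expMeasure hμ
  unfold markLaw
  infer_instance

/-- The power received at `0` from a station with the given position and mark; it is `0` if the
station does not transmit. -/
def powerFrom (pw α : ℝ) (z : Plane × (Bool × ℝ)) : ℝ≥0∞ :=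
  if z.2.1 = true then ENNReal.ofReal (z.2.2 * ‖z.1‖ ^ (-α) * pw) else 0

@[fun_prop]
lemma measurable_powerFrom (pw α : ℝ) : Measurable (powerFrom pw α) := by
  refine Measurable.ite ?_ (by fun_prop) measurable_const
  exact (measurable_fst.comp measurable_snd) (measurableSet_singleton true)

lemma lintegral_markLaw {q : unitInterval} {μ : ℝ} (hμ : 0 < μ) {g : Bool × ℝ → ℝ≥0∞}
    (hg : Measurable g) (hg0 : ∀ y, g (false, y) = 0) :
    ∫⁻ m, g m ∂(markLaw q μ) = ENNReal.ofReal q * ∫⁻ y, g (true, y) ∂(expMeasure μ) := by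
  have := isProbabilityMeasure_expMeasure hμ
  rw [markLaw, lintegral_prod _ hg.aemeasurable, bernoulliMeasure_def, lintegral_add_measure,
    lintegral_smul_measure, lintegral_smul_measure, lintegral_dirac, lintegral_dirac]
  simp only [hg0, lintegral_zero, smul_zero, add_zero]
  have : (unitInterval.toNNReal q : ℝ≥0∞) = ENNReal.ofReal q := by
    rw [← ENNReal.ofReal_coe_nnreal]; rfl
  rw [← this]; rfl

/-- The exponent of the Laplace functional of the interference from beyond distance `t`: the
fading is averaged out first, then the positions are integrated in polar coordinates. -/
lemma lintegral_one_sub_expNeg_powerFrom {lam : ℝ} (hlam : 0 ≤ lam) {q : unitInterval} {μ : ℝ}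
    (hμ : 0 < μ) {pw : ℝ} (hpw : 0 ≤ pw) (α : ℝ) {A : Set (Plane × (Bool × ℝ))}
    (hA : MeasurableSet A) (hAt : ∀ z, z.2.1 = true → z ∈ A) {s : ℝ → ℝ≥0∞} {σ t : ℝ}
    (hσ : 0 ≤ σ) (hst : s t = ENNReal.ofReal σ) (ht : 0 ≤ t) :
    ∫⁻ z, (1 - expNeg (farWeight A (fun z => ‖z.1‖) s (powerFrom pw α) t z))
        ∂(stationIntensity lam q μ) =
      ENNReal.ofReal (2 * Real.pi * (lam * q)) * ∫⁻ y in Ioi t,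
        ENNReal.ofReal (σ * (y ^ (-α) * pw) / μ / (1 + σ * (y ^ (-α) * pw) / μ) * y) := by
  have := isProbabilityMeasure_markLaw q hμ
  have hq : (0 : ℝ) ≤ q := q.2.1
  set h : ℝ → ℝ≥0∞ := fun y =>
    ENNReal.ofReal (σ * (y ^ (-α) * pw) / μ / (1 + σ * (y ^ (-α) * pw) / μ)) with hh
  have hhm : Measurable h := by fun_prop
  set f := farWeight A (fun z => ‖z.1‖) s (powerFrom pw α) t with hf
  have hfm : Measurable f := by
    refine Measurable.indicator (by fun_prop) (hA.inter (measurableSet_lt (by fun_prop) ?_))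
    fun_prop
  have hfv : ∀ x g, f (x, (false, g)) = 0 := fun x g => by
    simp [hf, farWeight, powerFrom]
  have hft : ∀ x g, f (x, (true, g)) =
      (Ioi t).indicator (fun _ => ENNReal.ofReal (g * (σ * (‖x‖ ^ (-α) * pw)))) ‖x‖ :=
    fun x g => by
    by_cases hx : t < ‖x‖
    · have hm : ((x, (true, g)) : Plane × (Bool × ℝ)) ∈ A ∩ {z | t < ‖z.1‖} :=
        ⟨hAt _ rfl, hx⟩
      rw [hf, farWeight, indicator_of_mem hm, indicator_of_mem (show ‖x‖ ∈ Ioi t from hx), hst,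
        powerFrom, if_pos rfl, ← ENNReal.ofReal_mul hσ]
      congr 1
      ring
    · have hm : ((x, (true, g)) : Plane × (Bool × ℝ)) ∉ A ∩ {z | t < ‖z.1‖} := fun h => hx h.2
      rw [hf, farWeight, indicator_of_notMem hm,
        indicator_of_notMem (show ‖x‖ ∉ Ioi t from hx)]
  have hinner : ∀ x : Plane, ∫⁻ m, (1 - expNeg (f (x, m))) ∂(markLaw q μ) =
      ENNReal.ofReal q * (Ioi t).indicator h ‖x‖ := fun x => by
    rw [lintegral_markLaw hμ (by fun_prop) (fun y => by simp [hfv, expNeg_zero])]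
    congr 1
    simp_rw [hft]
    by_cases hx : ‖x‖ ∈ Ioi t
    · simp_rw [indicator_of_mem hx]
      exact lintegral_one_sub_expNeg_expMeasure hμ (by positivity)
    · simp [indicator_of_notMem hx, expNeg_zero]
  rw [stationIntensity, lintegral_prod _ (by fun_prop)]
  simp_rw [hinner]
  rw [lintegral_smul_measure, lintegral_const_mul _ (show Measurable fun x : Plane =>
    (Ioi t).indicator h ‖x‖ from (hhm.indicator measurableSet_Ioi).comp measurable_norm),
    lintegral_fun_norm_plane (hhm.indicator measurableSet_Ioi), smul_eq_mul]
  have hy : ∫⁻ y in Ioi (0 : ℝ), ENNReal.ofReal y * (Ioi t).indicator h y =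
      ∫⁻ y in Ioi t, ENNReal.ofReal
        (σ * (y ^ (-α) * pw) / μ / (1 + σ * (y ^ (-α) * pw) / μ) * y) := by
    have : ∀ y, ENNReal.ofReal y * (Ioi t).indicator h y =
        (Ioi t).indicator (fun y => ENNReal.ofReal y * h y) y := fun y => by
      by_cases hy : y ∈ Ioi t <;> simp [hy]
    simp_rw [this]
    rw [lintegral_indicator measurableSet_Ioi, Measure.restrict_restrict measurableSet_Ioi,
      inter_eq_self_of_subset_left (Ioi_subset_Ioi ht)]
    refine setLIntegral_congr_fun measurableSet_Ioi fun y hy => ?_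
    have hy0 : 0 < y := ht.trans_lt hy
    simp only [hh]
    rw [mul_comm, ← ENNReal.ofReal_mul (by positivity)]
  rw [hy, ← mul_assoc, ← mul_assoc, ← ENNReal.ofReal_mul (by positivity),
    ← ENNReal.ofReal_mul (by positivity)]
  congr 2
  ring

lemma stationIntensity_disk {lam : ℝ} (hlam : 0 ≤ lam) (q : unitInterval) {μ : ℝ} (hμ : 0 < μ)
    {c : ℝ} (hc : 0 ≤ c) :
    stationIntensity lam q μ (univ ∩ {z | ‖z.1‖ < c}) = ENNReal.ofReal (Real.pi * lam * c ^ 2) := by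
  have := isProbabilityMeasure_markLaw q hμ
  have hset : univ ∩ {z : Plane × (Bool × ℝ) | ‖z.1‖ < c} = {x : Plane | ‖x‖ < c} ×ˢ univ := by
    ext z; simp
  rw [hset, stationIntensity, Measure.prod_prod, measure_univ, mul_one, Measure.smul_apply,
    volume_norm_lt_plane hc, smul_eq_mul, ← ENNReal.ofReal_mul hlam]
  congr 1
  ring

lemma stationIntensity_transmits_disk {lam : ℝ} (hlam : 0 ≤ lam) (q : unitInterval) {μ : ℝ}
    (hμ : 0 < μ) {c : ℝ} (hc : 0 ≤ c) :
    stationIntensity lam q μ ({z | z.2.1 = true} ∩ {z | ‖z.1‖ < c}) =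
      ENNReal.ofReal (Real.pi * (lam * q) * c ^ 2) := by
  have := isProbabilityMeasure_expMeasure hμ
  have hq : (0 : ℝ) ≤ q := q.2.1
  have hset : {z : Plane × (Bool × ℝ) | z.2.1 = true} ∩ {z | ‖z.1‖ < c} =
      {x : Plane | ‖x‖ < c} ×ˢ ({true} ×ˢ univ) := by
    ext z; simp [and_comm]
  have hb : bernoulliMeasure true false q {true} = ENNReal.ofReal q := by
    rw [bernoulliMeasure_apply _ (measurableSet_singleton _)]
    simp only [mem_singleton_iff, reduceCtorEq, if_true, if_false]
    rw [← ENNReal.ofReal_coe_nnreal]; rfl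
  rw [hset, stationIntensity, markLaw, Measure.prod_prod, Measure.prod_prod, measure_univ,
    mul_one, hb, Measure.smul_apply, volume_norm_lt_plane hc, smul_eq_mul,
    ← ENNReal.ofReal_mul hlam, ← ENNReal.ofReal_mul (by positivity)]
  congr 1
  ring

/-! ### Local finiteness and absence of ties -/

section Poisson

variable {Ω : Type*} [MeasurableSpace Ω] {E : Type*} [MeasurableSpace E]

/-- A set of infinite intensity contains a point almost surely. -/
lemma HasPoissonLaplace.exists_mem {Z : ℕ → Ω → E} {Λ : Measure E} {P : Measure Ω}
    (hL : HasPoissonLaplace Z Λ P) (hZ : ∀ n, Measurable (Z n)) {A : Set E}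
    (hA : MeasurableSet A) (hΛ : Λ A = ∞) : ∀ᵐ ω ∂P, ∃ n, Z n ω ∈ A := by
  have hm : Measurable (A.indicator fun _ : E => (1 : ℝ≥0∞)) := measurable_const.indicator hA
  have h := hL _ hm
  have h1 : ∀ z, 1 - expNeg (A.indicator (fun _ => 1) z) =
      A.indicator (fun _ => 1 - expNeg 1) z := fun z => by
    by_cases hz : z ∈ A <;> simp [hz, expNeg_zero]
  have hne : 1 - expNeg 1 ≠ 0 := by
    have : expNeg 1 < 1 := by
      rw [← ENNReal.ofReal_one, expNeg_ofReal zero_le_one]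
      exact ENNReal.ofReal_lt_ofReal_iff_of_nonneg (by positivity) |>.2 (by simp)
    exact (tsub_pos_of_lt this).ne'
  have hmm : Measurable fun ω => expNeg (∑' n, A.indicator (fun _ => (1 : ℝ≥0∞)) (Z n ω)) :=
    measurable_expNeg.comp (.tsum fun n => hm.comp (hZ n))
  simp_rw [h1] at h
  rw [lintegral_indicator_const hA, hΛ, ENNReal.mul_top hne, expNeg_top,
    lintegral_eq_zero_iff hmm] at h
  filter_upwards [h] with ω hω
  by_contra! hcon
  simp [hcon, expNeg_zero] at hω

lemma IsPoissonProcess.ae_count_ne_top {X : ℕ → Ω → E} {Λ : Measure E} {P : Measure Ω}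
    (hX : IsPoissonProcess X Λ P) {B : Set E} (hB : MeasurableSet B) (hΛ : Λ B < ∞) :
    ∀ᵐ ω ∂P, count X B ω ≠ ∞ := by
  have hlaw := hX.law_count B hB hΛ
  have h : ∀ᵐ y ∂(P.map (count X B)), y ≠ ∞ := by
    have hm : MeasurableSet {y : ℝ≥0∞ | y ≠ ∞} := (measurableSet_singleton _).compl
    rw [hlaw.map_eq, ae_map_iff (Measurable.of_discrete).aemeasurable hm]
    exact .of_forall fun k => ENNReal.natCast_ne_top k
  exact ae_of_ae_map hlaw.aemeasurable h

/-- A Poisson variable of mean `a` is at least `2` with probability at most `a ^ 2`. -/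
lemma poissonMeasure_two_le (a : ℝ≥0) : poissonMeasure a {k | 2 ≤ k} ≤ (a : ℝ≥0∞) ^ 2 := by
  have hset : {k : ℕ | 2 ≤ k} = ({0} ∪ {1})ᶜ := by
    ext k
    simp
    omega
  have hdisj : Disjoint ({0} : Set ℕ) {1} := by simp
  have h2 : (poissonMeasure a).real {k | 2 ≤ k} ≤ (a : ℝ) ^ 2 := by
    rw [hset, probReal_compl_eq_one_sub .of_discrete, measureReal_union hdisj .of_discrete,
      poissonMeasure_real_singleton, poissonMeasure_real_singleton]
    have he := Real.add_one_le_exp (-(a : ℝ))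
    have ha := a.coe_nonneg
    simp only [pow_zero, mul_one, Nat.factorial_zero, Nat.cast_one, div_one, pow_one,
      Nat.factorial_one]
    nlinarith [mul_le_mul_of_nonneg_right he (by linarith : (0 : ℝ) ≤ 1 + a)]
  rw [← ofReal_measureReal, ← ENNReal.ofReal_coe_nnreal, ← ENNReal.ofReal_pow a.coe_nonneg]
  exact ENNReal.ofReal_le_ofReal h2

lemma IsPoissonProcess.measure_exists_two_mem_le {X : ℕ → Ω → E} {Λ : Measure E} {P : Measure Ω}
    (hX : IsPoissonProcess X Λ P) {B : Set E} (hB : MeasurableSet B) (hΛ : Λ B < ∞) :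
    P {ω | ∃ n m, n ≠ m ∧ X n ω ∈ B ∧ X m ω ∈ B} ≤ Λ B ^ 2 := by
  have hsub : {ω | ∃ n m, n ≠ m ∧ X n ω ∈ B ∧ X m ω ∈ B} ⊆ {ω | 2 ≤ count X B ω} := by
    rintro ω ⟨n, m, hnm, hn, hm⟩
    have := ENNReal.sum_le_tsum (f := fun n => B.indicator (fun _ => (1 : ℝ≥0∞)) (X n ω)) {n, m}
    rw [Finset.sum_pair hnm, indicator_of_mem hn, indicator_of_mem hm, one_add_one_eq_two] at this
    exact this
  refine (measure_mono hsub).trans ?_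
  have hm : MeasurableSet {y : ℝ≥0∞ | 2 ≤ y} := measurableSet_Ici
  rw [(hX.law_count B hB hΛ).measure_eq (p := fun y => 2 ≤ y) hm,
    Measure.map_apply .of_discrete hm]
  have := poissonMeasure_two_le (Λ B).toNNReal
  rw [ENNReal.coe_toNNReal hΛ.ne] at this
  refine le_trans (le_of_eq ?_) this
  congr 1
  ext k
  simp

end Poisson

/-- The area of an annulus is proportional to the difference of the squared radii. -/
lemma volume_annulus {a b : ℝ} (ha : 0 ≤ a) (hab : a ≤ b) :
    volume {x : Plane | a ≤ ‖x‖ ^ 2 ∧ ‖x‖ ^ 2 < b} = ENNReal.ofReal (Real.pi * (b - a)) := by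
  have hlt : ∀ c : ℝ, {x : Plane | ‖x‖ ^ 2 < c} = {x | ‖x‖ < √c} := fun c => by
    ext x
    exact (Real.lt_sqrt (norm_nonneg x)).symm
  have hvol : ∀ c : ℝ, 0 ≤ c →
      volume {x : Plane | ‖x‖ ^ 2 < c} = ENNReal.ofReal (Real.pi * c) := fun c hc => by
    rw [hlt, volume_norm_lt_plane (Real.sqrt_nonneg c), Real.sq_sqrt hc]
  have hset : {x : Plane | a ≤ ‖x‖ ^ 2 ∧ ‖x‖ ^ 2 < b} =
      {x | ‖x‖ ^ 2 < b} \ {x | ‖x‖ ^ 2 < a} := by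
    ext x
    simp [and_comm]
  have hm : MeasurableSet {x : Plane | ‖x‖ ^ 2 < a} :=
    measurableSet_lt (by fun_prop) measurable_const
  have hpi := Real.pi_pos
  have hsub : {x : Plane | ‖x‖ ^ 2 < a} ⊆ {x | ‖x‖ ^ 2 < b} := fun x hx =>
    lt_of_lt_of_le (show ‖x‖ ^ 2 < a from hx) hab
  rw [hset, measure_sdiff hsub hm.nullMeasurableSet
    (by rw [hvol a ha]; exact ENNReal.ofReal_ne_top), hvol a ha, hvol b (ha.trans hab),
    ← ENNReal.ofReal_sub _ (by positivity)]
  congr 1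
  ring

/-- Almost surely, no two points of a homogeneous Poisson process are equally far from `0`. A disk
is cut into `N` annuli of equal area; some annulus contains two points with probability
`O(N · N⁻²)`. -/
lemma IsPoissonProcess.ae_norm_ne {Ω : Type*} [MeasurableSpace Ω] {X : ℕ → Ω → Plane} {lam : ℝ}
    (hlam : 0 ≤ lam) {P : Measure Ω}
    (hX : IsPoissonProcess X (ENNReal.ofReal lam • (volume : Measure Plane)) P) :
    ∀ᵐ ω ∂P, ∀ n m, n ≠ m → ‖X n ω‖ ≠ ‖X m ω‖ := by
  have hpi := Real.pi_pos
  have key : ∀ c : ℕ, P {ω | ∃ n m, n ≠ m ∧ ‖X n ω‖ = ‖X m ω‖ ∧ ‖X n ω‖ ^ 2 < c} = 0 := fun c => by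
    set C : ℝ := lam * (Real.pi * c) with hC
    have hbound : ∀ N : ℕ, P {ω | ∃ n m, n ≠ m ∧ ‖X n ω‖ = ‖X m ω‖ ∧ ‖X n ω‖ ^ 2 < c} ≤
        ENNReal.ofReal (C ^ 2 * (1 / ((N : ℝ) + 1))) := fun N => by
      have hN : (0 : ℝ) < (N : ℝ) + 1 := by positivity
      set B : ℕ → Set Plane := fun k =>
        {x | k * (c / ((N : ℝ) + 1)) ≤ ‖x‖ ^ 2 ∧ ‖x‖ ^ 2 < (k + 1) * (c / ((N : ℝ) + 1))} with hB
      have hnm : Measurable fun x : Plane => ‖x‖ ^ 2 := by fun_prop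
      have hBm : ∀ k, MeasurableSet (B k) := fun k =>
        (measurableSet_le measurable_const hnm).inter (measurableSet_lt hnm measurable_const)
      have hBv : ∀ k, (ENNReal.ofReal lam • (volume : Measure Plane)) (B k) =
          ENNReal.ofReal (C / ((N : ℝ) + 1)) := fun k => by
        rw [Measure.smul_apply, hB, volume_annulus (by positivity) (by gcongr; linarith),
          smul_eq_mul, ← ENNReal.ofReal_mul hlam]
        congr 1
        rw [hC]
        field_simp
        ring
      have hsub : {ω | ∃ n m, n ≠ m ∧ ‖X n ω‖ = ‖X m ω‖ ∧ ‖X n ω‖ ^ 2 < c} ⊆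
          ⋃ k ∈ Finset.range (N + 1), {ω | ∃ n m, n ≠ m ∧ X n ω ∈ B k ∧ X m ω ∈ B k} := by
        rintro ω ⟨n, m, hnm, heq, hlt⟩
        have hc : (0 : ℝ) < c := (sq_nonneg _).trans_lt hlt
        have hd : (0 : ℝ) < c / ((N : ℝ) + 1) := by positivity
        have h1 := Nat.floor_le (div_nonneg (sq_nonneg ‖X n ω‖) hd.le)
        have h2 := Nat.lt_floor_add_one (‖X n ω‖ ^ 2 / (c / ((N : ℝ) + 1)))
        set k := ⌊‖X n ω‖ ^ 2 / (c / ((N : ℝ) + 1))⌋₊ with hk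
        have hmem : X n ω ∈ B k := ⟨(le_div_iff₀ hd).1 h1, (div_lt_iff₀ hd).1 h2⟩
        have hkN : k < N + 1 := by
          have h3 : (k : ℝ) * (c / ((N : ℝ) + 1)) < c := hmem.1.trans_lt hlt
          rw [mul_div_assoc', div_lt_iff₀ hN, mul_comm, mul_lt_mul_iff_right₀ hc] at h3
          exact_mod_cast h3
        refine mem_biUnion (Finset.mem_coe.2 (Finset.mem_range.2 hkN)) ⟨n, m, hnm, hmem, ?_⟩
        simp only [hB, mem_ofPred_eq] at hmem ⊢
        rwa [← heq]
      calc _ ≤ ∑ k ∈ Finset.range (N + 1),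
            P {ω | ∃ n m, n ≠ m ∧ X n ω ∈ B k ∧ X m ω ∈ B k} :=
            (measure_mono hsub).trans (measure_biUnion_finset_le _ _)
        _ ≤ ∑ k ∈ Finset.range (N + 1), ENNReal.ofReal (C / ((N : ℝ) + 1)) ^ 2 :=
            Finset.sum_le_sum fun k _ => hBv k ▸ hX.measure_exists_two_mem_le (hBm k)
              (by rw [hBv k]; exact ENNReal.ofReal_lt_top)
        _ = ENNReal.ofReal (C ^ 2 * (1 / ((N : ℝ) + 1))) := by
            rw [Finset.sum_const, Finset.card_range, nsmul_eq_mul,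
              ← ENNReal.ofReal_pow (by positivity), ← ENNReal.ofReal_natCast,
              ← ENNReal.ofReal_mul (by positivity)]
            congr 1
            push_cast
            field_simp
    have hlim := ENNReal.tendsto_ofReal
      ((tendsto_one_div_add_atTop_nhds_zero_nat (𝕜 := ℝ)).const_mul (C ^ 2))
    rw [mul_zero, ENNReal.ofReal_zero] at hlim
    exact le_antisymm (ge_of_tendsto' hlim hbound) zero_le
  have hall : ∀ᵐ ω ∂P, ∀ c : ℕ, ¬ ∃ n m, n ≠ m ∧ ‖X n ω‖ = ‖X m ω‖ ∧ ‖X n ω‖ ^ 2 < c :=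
    ae_all_iff.2 fun c => by
      rw [ae_iff]
      simpa using key c
  filter_upwards [hall] with ω hω n m hnm heq
  obtain ⟨c, hc⟩ := exists_nat_gt (‖X n ω‖ ^ 2)
  exact hω c ⟨n, m, hnm, heq, hc⟩

lemma IsPoissonProcess.ae_finite_norm_lt {Ω : Type*} [MeasurableSpace Ω] {X : ℕ → Ω → Plane}
    {lam : ℝ} {P : Measure Ω}
    (hX : IsPoissonProcess X (ENNReal.ofReal lam • (volume : Measure Plane)) P) :
    ∀ᵐ ω ∂P, ∀ c : ℝ, {n | ‖X n ω‖ < c}.Finite := by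
  have h : ∀ᵐ ω ∂P, ∀ c : ℕ, count X (Metric.ball 0 c) ω ≠ ∞ := ae_all_iff.2 fun c =>
    hX.ae_count_ne_top measurableSet_ball (by
      rw [Measure.smul_apply, smul_eq_mul]
      exact ENNReal.mul_lt_top ENNReal.ofReal_lt_top measure_ball_lt_top)
  filter_upwards [h] with ω hω c
  obtain ⟨b, hb⟩ := exists_nat_gt c
  refine (ENNReal.finite_const_le_of_tsum_ne_top (hω b) one_ne_zero).subset fun n hn => ?_
  have : X n ω ∈ Metric.ball (0 : Plane) b := by
    simpa using lt_trans (show ‖X n ω‖ < c from hn) hb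
  simp [this]

/-! ### The nearest station and the interference: measurability -/

namespace Stations

variable {Ω : Type*}

/-- If every disk contains finitely many stations, then the nearest one is attained, so that the
infimum that defines its index is not the junk value `0` of an empty infimum. -/
lemma nearest_spec (S : Stations Ω) {A : Set ℕ} {ω : Ω} (hA : A.Nonempty)
    (hfin : ∀ c : ℝ, {n | ‖S.pos n ω‖ < c}.Finite) :
    S.nearest A ω ∈ A ∧ ∀ m ∈ A, ‖S.pos (S.nearest A ω) ω‖ ≤ ‖S.pos m ω‖ := by
  obtain ⟨n₀, hn₀⟩ := hA
  obtain ⟨k, hk, hmin⟩ := ((hfin (‖S.pos n₀ ω‖ + 1)).inter_of_right A).exists_minimalFor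
    (fun n => ‖S.pos n ω‖) _ ⟨n₀, hn₀, by simp⟩
  refine Nat.sInf_mem (s := {n | n ∈ A ∧ ∀ m ∈ A, ‖S.pos n ω‖ ≤ ‖S.pos m ω‖})
    ⟨k, hk.1, fun m hm => ?_⟩
  by_cases h : ‖S.pos m ω‖ < ‖S.pos n₀ ω‖ + 1
  · by_contra! hlt
    exact absurd (hmin ⟨hm, h⟩ hlt.le) (not_le.2 hlt)
  · exact le_trans (le_of_lt hk.2) (not_lt.1 h)

variable [MeasurableSpace Ω]

lemma measurable_pos {S : Stations Ω} (hS : Measurable S.all) (n : ℕ) : Measurable (S.pos n) :=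
  measurable_fst.comp ((measurable_pi_apply n).comp hS)

lemma measurable_sInf_nat {q : ℕ → Ω → Prop} (hq : ∀ n, Measurable (q n)) :
    Measurable fun ω => sInf {n | q n ω} := by
  refine measurable_to_countable' fun k => ?_
  -- the second alternative accounts for `sInf ∅ = 0`
  have hset : (fun ω => sInf {n | q n ω}) ⁻¹' {k} =
      {ω | (q k ω ∧ ∀ j, j < k → ¬ q j ω) ∨ (k = 0 ∧ ∀ j, ¬ q j ω)} := by
    ext ω
    simp only [mem_preimage, mem_singleton_iff, mem_ofPred_eq]
    by_cases hne : ∃ n, q n ω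
    · have hmem := Nat.sInf_mem (s := {n | q n ω}) hne
      constructor
      · rintro rfl
        exact .inl ⟨hmem, fun j hj => Nat.notMem_of_lt_sInf hj⟩
      · rintro (⟨h1, h2⟩ | ⟨-, h2⟩)
        · refine le_antisymm (Nat.sInf_le h1) ?_
          by_contra! hlt
          exact h2 _ hlt hmem
        · exact absurd hne (by simpa using h2)
    · have hempty : {n | q n ω} = ∅ := by
        ext n
        simpa using fun h => hne ⟨n, h⟩
      rw [hempty, Nat.sInf_empty]
      push Not at hne
      simp [hne, eq_comm]
  rw [hset]
  refine measurableSet_setOfPred.2 (((hq k).and (.forall fun j => ?_)).or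
    (measurable_const.and (.forall fun j => (hq j).not)))
  exact measurable_const.imp (hq j).not

lemma measurable_nearest {S : Stations Ω} (hS : Measurable S.all)
    {A : Set (Plane × (Bool × ℝ))} (hA : MeasurableSet A) :
    Measurable fun ω => S.nearest {n | S.all ω n ∈ A} ω := by
  have hmem : ∀ n, Measurable fun ω => S.all ω n ∈ A := fun n =>
    measurableSet_setOfPred.1 (((measurable_pi_apply n).comp hS) hA)
  have hle : ∀ n m, Measurable fun ω => ‖S.pos n ω‖ ≤ ‖S.pos m ω‖ := fun n m =>
    measurableSet_setOfPred.1
      (measurableSet_le (measurable_pos hS n).norm (measurable_pos hS m).norm)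
  exact measurable_sInf_nat fun n => (hmem n).and (.forall fun m => (hmem m).imp (hle n m))

lemma measurable_interference {S : Stations Ω} (hS : Measurable S.all) (pw α : ℝ) {k : Ω → ℕ}
    (hk : Measurable k) : Measurable fun ω => S.interference pw α (k ω) ω := by
  unfold interference
  refine .tsum fun n => Measurable.ite ?_ ?_ measurable_const
  · refine MeasurableSet.inter ?_ ?_
    · exact (measurable_fst.comp (measurable_snd.comp ((measurable_pi_apply n).comp hS)))
        (measurableSet_singleton true)
    · exact (measurableSet_eq_fun measurable_const hk).compl
  · have h : Measurable fun z : Plane × (Bool × ℝ) =>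
        ENNReal.ofReal (z.2.2 * ‖z.1‖ ^ (-α) * pw) := by fun_prop
    exact h.comp ((measurable_pi_apply n).comp hS)

end Stations

/-! ### Interference of a marked Poisson field -/

namespace Stations.IsMarkedPoisson

variable {Ω : Type*} [MeasurableSpace Ω] {P : Measure Ω} {S : Stations Ω} {lam : ℝ}
  {q : unitInterval} {μ : ℝ}

lemma measurable_all (hS : S.IsMarkedPoisson lam q μ P) : Measurable S.all :=
  measurable_pi_lambda _ fun n => (hS.poisson.measurable n).prodMk (hS.measurable_mark n)

/-- A field of stations with its marks is a Poisson process on pairs of a position and a mark. -/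
lemma hasPoissonLaplace [IsProbabilityMeasure P] (hS : S.IsMarkedPoisson lam q μ P) (hμ : 0 < μ) :
    HasPoissonLaplace (fun n ω => S.all ω n) (stationIntensity lam q μ) P := by
  have := isProbabilityMeasure_markLaw q hμ
  have : SigmaFinite (ENNReal.ofReal lam • (volume : Measure Plane)) :=
    inferInstanceAs (SigmaFinite (lam.toNNReal • (volume : Measure Plane)))
  exact hS.poisson.hasPoissonLaplace.marking hS.poisson.measurable hS.measurable_mark
    (fun n => (hS.law_mark n).map_eq) hS.indep_mark hS.indep_pos_mark

section Nearest

variable {A : Set (Plane × (Bool × ℝ))} {l : ℝ}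

lemma ae_nearest_spec [IsProbabilityMeasure P]
    (hS : S.IsMarkedPoisson lam q μ P) (hμ : 0 < μ) (hA : MeasurableSet A)
    (hl : 0 < l) (hΛ : ∀ c, 0 ≤ c → stationIntensity lam q μ (A ∩ {z | ‖z.1‖ < c}) =
      ENNReal.ofReal (Real.pi * l * c ^ 2)) :
    ∀ᵐ ω ∂P, S.all ω (S.nearest {n | S.all ω n ∈ A} ω) ∈ A ∧
      ∀ m, S.all ω m ∈ A → ‖S.pos (S.nearest {n | S.all ω n ∈ A} ω) ω‖ ≤ ‖S.pos m ω‖ := by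
  have hpi := Real.pi_pos
  have htop : stationIntensity lam q μ A = ∞ := by
    refine ENNReal.eq_top_of_forall_nnreal_le fun x => ?_
    refine le_trans (le_of_eq ?_) (measure_mono (inter_subset_left (t := {z | ‖z.1‖ <
      √(x / (Real.pi * l))})))
    rw [hΛ _ (Real.sqrt_nonneg _), Real.sq_sqrt (by positivity), mul_div_cancel₀ _ (by positivity),
      ENNReal.ofReal_coe_nnreal]
  have hZ : ∀ n, Measurable fun ω => S.all ω n := fun n =>
    (measurable_pi_apply n).comp hS.measurable_all
  filter_upwards [(hS.hasPoissonLaplace hμ).exists_mem hZ hA htop, hS.poisson.ae_finite_norm_lt]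
    with ω hne hfin
  exact S.nearest_spec (A := {n | S.all ω n ∈ A}) hne hfin

lemma isNearestDist [IsProbabilityMeasure P]
    (hS : S.IsMarkedPoisson lam q μ P) (hμ : 0 < μ) (hA : MeasurableSet A)
    (hl : 0 < l) (hΛ : ∀ c, 0 ≤ c → stationIntensity lam q μ (A ∩ {z | ‖z.1‖ < c}) =
      ENNReal.ofReal (Real.pi * l * c ^ 2)) :
    IsNearestDist (fun n ω => S.all ω n) A (fun z => ‖z.1‖)
      (fun ω => ‖S.pos (S.nearest {n | S.all ω n ∈ A} ω) ω‖) P := by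
  filter_upwards [hS.ae_nearest_spec hμ hA hl hΛ] with ω hω c
  exact ⟨fun hc n hn => hc.trans (hω.2 n hn), fun h => h _ hω.1⟩

lemma measurable_nearestDist (hS : S.IsMarkedPoisson lam q μ P) (hA : MeasurableSet A) :
    Measurable fun ω => ‖S.pos (S.nearest {n | S.all ω n ∈ A} ω) ω‖ := by
  have h : Measurable fun x : ℕ × Ω => ‖S.pos x.1 x.2‖ :=
    measurable_from_prod_countable_right fun n => (hS.poisson.measurable n).norm
  have hk := (measurable_nearest hS.measurable_all hA).prodMk (measurable_id' (α := Ω))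
  exact Measurable.comp (f := fun ω => (S.nearest {n | S.all ω n ∈ A} ω, ω)) h hk

/-- The distance of the nearest station in `A` is Rayleigh distributed. -/
lemma map_nearestDist [IsProbabilityMeasure P]
    (hS : S.IsMarkedPoisson lam q μ P) (hμ : 0 < μ) (hA : MeasurableSet A)
    (hl : 0 < l) (hΛ : ∀ c, 0 ≤ c → stationIntensity lam q μ (A ∩ {z | ‖z.1‖ < c}) =
      ENNReal.ofReal (Real.pi * l * c ^ 2)) :
    P.map (fun ω => ‖S.pos (S.nearest {n | S.all ω n ∈ A} ω) ω‖) =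
      (volume.restrict (Ioi 0)).withDensity
        fun t => ENNReal.ofReal (2 * Real.pi * l * t * Real.exp (-Real.pi * l * t ^ 2)) :=
  (hS.hasPoissonLaplace hμ).map_nearestDist hA (by fun_prop) (hS.measurable_nearestDist hA)
    (hS.isNearestDist hμ hA hl hΛ) (fun _ => norm_nonneg _) hl hΛ

/-- Almost surely there are no ties, so that leaving out the nearest station of `A` is the same as
keeping those beyond its distance. -/
lemma ae_mul_interference [IsProbabilityMeasure P]
    (hS : S.IsMarkedPoisson lam q μ P) (hlam : 0 ≤ lam) (hμ : 0 < μ)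
    (hA : MeasurableSet A) (hAt : ∀ z, z.2.1 = true → z ∈ A)
    (hl : 0 < l) (hΛ : ∀ c, 0 ≤ c → stationIntensity lam q μ (A ∩ {z | ‖z.1‖ < c}) =
      ENNReal.ofReal (Real.pi * l * c ^ 2)) (pw α : ℝ) (s : ℝ → ℝ≥0∞) :
    ∀ᵐ ω ∂P, s ‖S.pos (S.nearest {n | S.all ω n ∈ A} ω) ω‖ *
        S.interference pw α (S.nearest {n | S.all ω n ∈ A} ω) ω =
      ∑' n, farWeight A (fun z => ‖z.1‖) s (powerFrom pw α)
        ‖S.pos (S.nearest {n | S.all ω n ∈ A} ω) ω‖ (S.all ω n) := by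
  filter_upwards [hS.ae_nearest_spec hμ hA hl hΛ, hS.poisson.ae_norm_ne hlam] with ω hω hne
  rw [interference, ← ENNReal.tsum_mul_left]
  refine tsum_congr fun n => ?_
  set k := S.nearest {n | S.all ω n ∈ A} ω
  by_cases ht : S.transmits n ω = true
  · have hn : S.all ω n ∈ A := hAt _ ht
    by_cases hnk : n = k
    · have : S.all ω n ∉ A ∩ {z | ‖S.pos k ω‖ < ‖z.1‖} := fun h => by
        have h2 : ‖S.pos k ω‖ < ‖S.pos n ω‖ := h.2
        rw [hnk] at h2
        exact lt_irrefl _ h2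
      rw [farWeight, indicator_of_notMem this]
      simp [hnk]
    · have : S.all ω n ∈ A ∩ {z | ‖S.pos k ω‖ < ‖z.1‖} :=
        ⟨hn, lt_of_le_of_ne (hω.2 n hn) (hne k n (Ne.symm hnk))⟩
      rw [farWeight, indicator_of_mem this, if_pos ⟨ht, hnk⟩, powerFrom]
      exact congrArg _ (if_pos ht).symm
  · have hp : powerFrom pw α (S.all ω n) = 0 := if_neg ht
    rw [farWeight, if_neg (fun h => ht h.1), mul_zero]
    by_cases hn : S.all ω n ∈ A ∩ {z | ‖S.pos k ω‖ < ‖z.1‖}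
    · rw [indicator_of_mem hn, hp, mul_zero]
    · rw [indicator_of_notMem hn]

/-- The joint transform of the distance of the nearest station in `A` and of the interference from
the other ones. Here `l` is the density of the stations in `A`, and all transmitting stations belong
to `A`. -/
theorem lintegral_interference [IsProbabilityMeasure P]
    (hS : S.IsMarkedPoisson lam q μ P) (hlam : 0 ≤ lam) (hμ : 0 < μ)
    (hA : MeasurableSet A) (hAt : ∀ z, z.2.1 = true → z ∈ A)
    (hl : 0 < l) (hΛ : ∀ c, 0 ≤ c → stationIntensity lam q μ (A ∩ {z | ‖z.1‖ < c}) =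
      ENNReal.ofReal (Real.pi * l * c ^ 2)) {pw : ℝ} (hpw : 0 ≤ pw) (α : ℝ) {σ : ℝ → ℝ}
    (hσ : Continuous σ) (hσm : MonotoneOn σ (Ici 0)) (hσ0 : ∀ t, 0 ≤ t → 0 ≤ σ t)
    {φ : ℝ → ℝ≥0∞} (hφ : Measurable φ) :
    ∫⁻ ω, φ ‖S.pos (S.nearest {n | S.all ω n ∈ A} ω) ω‖ *
        expNeg (ENNReal.ofReal (σ ‖S.pos (S.nearest {n | S.all ω n ∈ A} ω) ω‖) *
          S.interference pw α (S.nearest {n | S.all ω n ∈ A} ω) ω) ∂P =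
      ∫⁻ t in Ioi (0 : ℝ),
        ENNReal.ofReal (2 * Real.pi * l * t * Real.exp (-Real.pi * l * t ^ 2)) *
          (φ t * expNeg (ENNReal.ofReal (2 * Real.pi * (lam * q)) * ∫⁻ y in Ioi t, ENNReal.ofReal
            (σ t * (y ^ (-α) * pw) / μ / (1 + σ t * (y ^ (-α) * pw) / μ) * y))) := by
  have := isProbabilityMeasure_markLaw q hμ
  have hsf : SFinite (stationIntensity lam q μ) := by unfold stationIntensity; infer_instance
  set s : ℝ → ℝ≥0∞ := fun t => ENNReal.ofReal (σ t) with hs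
  have hρ : Measurable fun z : Plane × (Bool × ℝ) => ‖z.1‖ := by fun_prop
  have hw : ∀ z, powerFrom pw α z ≠ ∞ := fun z => by
    unfold powerFrom
    split_ifs <;> simp
  have hsc : Continuous s := ENNReal.continuous_ofReal.comp hσ
  have hmain := (hS.hasPoissonLaplace hμ).lintegral_far (s := s) (φ := φ)
    (fun n => (measurable_pi_apply n).comp hS.measurable_all) hA hρ (hS.measurable_nearestDist hA)
    (hS.isNearestDist hμ hA hl hΛ) (fun _ => norm_nonneg _) hsc
    (fun a ha b hb hab => ENNReal.ofReal_le_ofReal (hσm ha hb hab))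
    (measurable_powerFrom pw α) hw hφ
  have hG : Measurable fun t => expNeg (∫⁻ z, (1 - expNeg
      (farWeight A (fun z => ‖z.1‖) s (powerFrom pw α) t z)) ∂(stationIntensity lam q μ)) :=
    measurable_expNeg.comp (Measurable.lintegral_prod_right'
      (f := fun x : ℝ × _ => 1 - expNeg (farWeight A _ s (powerFrom pw α) x.1 x.2))
      (measurable_const.sub (measurable_expNeg.comp
        (measurable_farWeight hA hρ hsc.measurable (measurable_powerFrom pw α)))))
  rw [hS.map_nearestDist hμ hA hl hΛ, lintegral_withDensity_eq_lintegral_mul _ (by fun_prop)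
    (show Measurable fun t => φ t * expNeg (∫⁻ z, (1 - expNeg
      (farWeight A (fun z => ‖z.1‖) s (powerFrom pw α) t z)) ∂(stationIntensity lam q μ)) from
      hφ.mul hG)] at hmain
  refine Eq.trans (lintegral_congr_ae ?_) (hmain.trans
    (setLIntegral_congr_fun measurableSet_Ioi fun t ht => ?_))
  · filter_upwards [hS.ae_mul_interference hlam hμ hA hAt hl hΛ pw α s] with ω hω
    rw [← hω]
  · have ht0 : (0 : ℝ) ≤ t := le_of_lt ht
    simp only [Pi.mul_apply]
    rw [lintegral_one_sub_expNeg_powerFrom (s := s) (σ := σ t) (t := t) hlam hμ hpw α hA hAt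
      (hσ0 t ht0) rfl ht0]

end Nearest

end Stations.IsMarkedPoisson

/-! ### Independence -/

section Independence

variable {Ω : Type*} [MeasurableSpace Ω] {P : Measure Ω}

/-- Regrouping of three independent variables. -/
lemma _root_.ProbabilityTheory.IndepFun.prodMk_right_of_prodMk_left [IsProbabilityMeasure P]
    {α β γ : Type*} [MeasurableSpace α]
    [MeasurableSpace β] [MeasurableSpace γ] {X : Ω → α} {Y : Ω → β} {Z : Ω → γ}
    (hXY : IndepFun X Y P) (hXYZ : IndepFun (fun ω => (X ω, Y ω)) Z P) (hX : Measurable X)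
    (hY : Measurable Y) (hZ : Measurable Z) : IndepFun X (fun ω => (Y ω, Z ω)) P := by
  have hYZ : IndepFun Y Z P := hXYZ.comp measurable_snd measurable_id
  rw [indepFun_iff_map_prod_eq_prod_map_map (by fun_prop) (by fun_prop)] at *
  have : IsProbabilityMeasure (P.map X) := Measure.isProbabilityMeasure_map hX.aemeasurable
  have : IsProbabilityMeasure (P.map Y) := Measure.isProbabilityMeasure_map hY.aemeasurable
  have : IsProbabilityMeasure (P.map Z) := Measure.isProbabilityMeasure_map hZ.aemeasurable
  rw [hYZ, ← Measure.prodAssoc_prod, ← hXY, ← hXYZ, Measure.map_map (by fun_prop) (by fun_prop)]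
  rfl

/-- Integrating out an independent variable. -/
lemma lintegral_indepFun [IsFiniteMeasure P] {α β : Type*} [MeasurableSpace α] [MeasurableSpace β]
    {X : Ω → α}
    {Y : Ω → β} (hXY : IndepFun X Y P) (hX : Measurable X) (hY : Measurable Y)
    {F : α × β → ℝ≥0∞} (hF : Measurable F) :
    ∫⁻ ω, F (X ω, Y ω) ∂P = ∫⁻ ω, ∫⁻ y, F (X ω, y) ∂(P.map Y) ∂P := by
  calc ∫⁻ ω, F (X ω, Y ω) ∂P = ∫⁻ v, F v ∂(P.map fun ω => (X ω, Y ω)) :=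
        (lintegral_map hF (hX.prodMk hY)).symm
    _ = ∫⁻ x, ∫⁻ y, F (x, y) ∂(P.map Y) ∂(P.map X) := by
        rw [(indepFun_iff_map_prod_eq_prod_map_map hX.aemeasurable hY.aemeasurable).1 hXY,
          lintegral_prod _ hF.aemeasurable]
    _ = _ := lintegral_map hF.lintegral_prod_right' hX

/-- An exponential variable exceeds an independent threshold `c` with conditional probability
`e^{-μ c}`. -/
lemma measure_le_ofReal_of_indepFun [IsProbabilityMeasure P] {α : Type*} [MeasurableSpace α]
    {V : Ω → α} {Y : Ω → ℝ}
    (hVY : IndepFun V Y P) (hV : Measurable V) (hY : Measurable Y) {μ : ℝ} (hμ : 0 < μ)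
    (hlaw : P.map Y = expMeasure μ) {B : Set α} (hB : MeasurableSet B) {c : α → ℝ≥0∞}
    (hc : Measurable c) :
    P {ω | V ω ∈ B ∧ c (V ω) ≤ ENNReal.ofReal (Y ω)} =
      ∫⁻ ω in {ω | V ω ∈ B}, expNeg (ENNReal.ofReal μ * c (V ω)) ∂P := by
  set D : Set (α × ℝ) := {v | v.1 ∈ B ∧ c v.1 ≤ ENNReal.ofReal v.2} with hD
  have hDm : MeasurableSet D := (measurable_fst hB).inter
    (measurableSet_le (hc.comp measurable_fst) (by fun_prop))
  have h1 : P {ω | V ω ∈ B ∧ c (V ω) ≤ ENNReal.ofReal (Y ω)} =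
      ∫⁻ ω, D.indicator 1 (V ω, Y ω) ∂P := by
    rw [← lintegral_indicator_one (show MeasurableSet
      {ω | V ω ∈ B ∧ c (V ω) ≤ ENNReal.ofReal (Y ω)} from (hV.prodMk hY) hDm)]
    rfl
  rw [h1, lintegral_indepFun hVY hV hY (measurable_one.indicator hDm),
    ← lintegral_indicator (show MeasurableSet {ω | V ω ∈ B} from hV hB), hlaw]
  refine lintegral_congr fun ω => ?_
  by_cases hω : V ω ∈ B
  · rw [indicator_of_mem (show ω ∈ {ω | V ω ∈ B} from hω), ← expMeasure_le_ofReal hμ,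
      ← lintegral_indicator_one (measurableSet_le measurable_const (by fun_prop))]
    refine lintegral_congr fun y => ?_
    simp [indicator, hD, hω]
  · rw [indicator_of_notMem (show ω ∉ {ω | V ω ∈ B} from hω)]
    simp [indicator, hD, hω]

/-- A member of an independent family is independent of the family in which it is overwritten by a
constant. -/
lemma _root_.ProbabilityTheory.iIndepFun.indepFun_ite {β : Type*} [MeasurableSpace β]
    {M : ℕ → Ω → β} (hM : iIndepFun M P)
    (hMm : ∀ n, Measurable (M n)) (k : ℕ) (b : β) :
    IndepFun (M k) (fun ω n => if n = k then b else M n ω) P := by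
  have h := indep_iSup_of_disjoint (fun n => (hMm n).comap_le) hM
    (disjoint_compl_right (a := ({k} : Set ℕ)))
  rw [IndepFun_iff_Indep]
  refine indep_of_indep_of_le_left (indep_of_indep_of_le_right h ?_) ?_
  · rw [← measurable_iff_comap_le]
    refine @measurable_pi_lambda _ _ _ (_) _ _ fun n => ?_
    by_cases hn : n = k
    · simp only [hn, if_true]
      exact measurable_const
    · simp only [hn, if_false]
      rw [measurable_iff_comap_le]
      exact le_iSup₂_of_le (f := fun i (_ : i ∈ ({k}ᶜ : Set ℕ)) => MeasurableSpace.comap (M i) _)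
        n hn le_rfl
  · exact le_iSup₂_of_le (f := fun i (_ : i ∈ ({k} : Set ℕ)) => MeasurableSpace.comap (M i) _)
        k rfl le_rfl

end Independence

/-! ### Parameters of the model -/

namespace Params

variable (p : Params)

lemma lamC_pos : 0 < p.lamC := add_pos p.lamU_pos p.lamD_pos

lemma lamC_mul_probU : p.lamC * p.probU = p.lamU :=
  mul_div_cancel₀ p.lamU p.lamC_pos.ne'

lemma lamC_mul_probD : p.lamC * p.probD = p.lamD := by
  have h : (p.probD : ℝ) = 1 - p.probU := rfl
  rw [h, mul_sub, lamC_mul_probU, lamC]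
  ring

lemma continuous_s : Continuous p.s := by
  have := p.α_pos.le
  unfold s
  exact (continuous_const.mul (Real.continuous_rpow_const this)).div_const _

lemma s_nonneg {t : ℝ} (ht : 0 ≤ t) : 0 ≤ p.s t := by
  have := p.μ_pos; have := p.β_pos; have := p.PM_pos
  unfold s
  positivity

lemma monotoneOn_s : MonotoneOn p.s (Ici 0) := fun a ha b _ hab => by
  have := p.μ_pos; have := p.β_pos; have := p.PM_pos; have := p.α_pos
  have ha : 0 ≤ a := ha
  unfold s
  gcongr

lemma s_mul_div {r y : ℝ} (hr : 0 ≤ r) (hy : 0 < y) (pw : ℝ) :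
    p.s r * (y ^ (-p.α) * pw) / p.μ = p.β * (pw / p.PM) * (r / y) ^ p.α := by
  have := p.μ_pos; have := p.PM_pos
  have := Real.rpow_pos_of_pos hy p.α
  rw [s, Real.div_rpow hr hy.le, Real.rpow_neg hy.le]
  field_simp

lemma lPsi_eq {r : ℝ} (hr : 0 < r) : p.lPsi r = ∫⁻ t in Ioi (0 : ℝ),
    ENNReal.ofReal (2 * Real.pi * (p.lamC * p.probD) * t *
        Real.exp (-Real.pi * (p.lamC * p.probD) * t ^ 2)) *
      (1 * expNeg (ENNReal.ofReal (2 * Real.pi * (p.lamC * p.probD)) * ∫⁻ y in Ioi t,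
        ENNReal.ofReal (p.s r * (y ^ (-p.α) * p.PB) / p.μ /
          (1 + p.s r * (y ^ (-p.α) * p.PB) / p.μ) * y))) := by
  rw [lPsi, lamC_mul_probD]
  refine setLIntegral_congr_fun measurableSet_Ioi fun t ht => ?_
  have h : ∀ y ∈ Ioi t, _ := fun y hy => p.s_mul_div hr.le ((mem_Ioi.1 ht).trans hy) p.PB
  simp only [one_mul]
  congr 3
  exact setLIntegral_congr_fun measurableSet_Ioi fun y hy => by simp only [h y hy]

lemma lPhi_eq {r : ℝ} (hr : 0 < r) : p.lPhi r =
    expNeg (ENNReal.ofReal (2 * Real.pi * (p.lamC * p.probU)) * ∫⁻ y in Ioi r,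
      ENNReal.ofReal (p.s r * (y ^ (-p.α) * p.PM) / p.μ /
        (1 + p.s r * (y ^ (-p.α) * p.PM) / p.μ) * y)) := by
  rw [lPhi, lamC_mul_probU]
  congr 2
  refine setLIntegral_congr_fun measurableSet_Ioi fun y hy => ?_
  simp only [p.s_mul_div hr.le (hr.trans hy) p.PM, div_self p.PM_pos.ne', mul_one]

lemma measurable_lPhi : Measurable p.lPhi := by
  have h : Measurable fun v : ℝ × ℝ => (Ioi v.1).indicator (fun y => ENNReal.ofReal
      ((p.β * (v.1 / y) ^ p.α) / (1 + p.β * (v.1 / y) ^ p.α) * y)) v.2 := by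
    have hf : Measurable fun v : ℝ × ℝ => ENNReal.ofReal
      ((p.β * (v.1 / v.2) ^ p.α) / (1 + p.β * (v.1 / v.2) ^ p.α) * v.2) := by fun_prop
    exact hf.indicator (measurableSet_lt measurable_fst measurable_snd)
  have h2 : p.lPhi = fun r => expNeg (ENNReal.ofReal (2 * Real.pi * p.lamU) *
      ∫⁻ y, (Ioi r).indicator (fun y => ENNReal.ofReal
        ((p.β * (r / y) ^ p.α) / (1 + p.β * (r / y) ^ p.α) * y)) y) := by
    funext r
    rw [lintegral_indicator measurableSet_Ioi, lPhi]
  rw [h2]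
  exact measurable_expNeg.comp (h.lintegral_prod_right'.const_mul _)

/-- The Rayleigh density of the distance of the served mobile station. -/
def servedPDF (t : ℝ) : ℝ≥0∞ :=
  ENNReal.ofReal (2 * Real.pi * p.lamC * t * Real.exp (-Real.pi * p.lamC * t ^ 2))

lemma measurable_servedPDF : Measurable p.servedPDF := by
  unfold servedPDF
  fun_prop

end Params

lemma measurable_laplace {α : Type*} [MeasurableSpace α] {κ : Kernel α ℝ≥0∞} [IsSFiniteKernel κ]
    {s : α → ℝ} (hs : Measurable s) : Measurable fun a => laplace (κ a) (s a) := by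
  unfold laplace
  exact Measurable.lintegral_kernel_prod_right' (κ := κ)
    (f := fun v : α × ℝ≥0∞ => expNeg (ENNReal.ofReal (s v.1) * v.2)) (by fun_prop)

/-! ### Fields of stations as sequences -/

/-- A sequence of positions and marks, regarded as a field of stations. Quantities of a field `S`
are those of `coordStations`, composed with `S.all`; this makes them functions of `S.all`, so that
independence of the fields passes to them. -/
def coordStations : Stations (ℕ → Plane × (Bool × ℝ)) where
  pos n z := (z n).1
  transmits n z := (z n).2.1
  gain n z := (z n).2.2

lemma measurable_all_coordStations : Measurable coordStations.all := measurable_id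

/-- Overwrite the mark of station `k` by a constant. The result no longer depends on the fading of
station `k`, but determines its distance and the interference from the other stations. -/
def eraseMark (k : ℕ) (z : ℕ → Plane × (Bool × ℝ)) (n : ℕ) : Plane × (Bool × ℝ) :=
  ((z n).1, if n = k then (false, 0) else (z n).2)

lemma interference_eraseMark (pw α : ℝ) (k : ℕ) (z : ℕ → Plane × (Bool × ℝ)) :
    coordStations.interference pw α k (eraseMark k z) = coordStations.interference pw α k z := by
  unfold Stations.interference
  refine tsum_congr fun n => ?_
  by_cases hn : n = k
  · simp [hn]
  · simp [hn, coordStations, eraseMark, Stations.received]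

/-! ### Interference in the network -/

lemma Network.servedDist_eq {Ω : Type*} (N : Network Ω) : N.servedDist =
    fun ω => ‖N.ms.pos (N.ms.nearest {n | N.ms.all ω n ∈ univ} ω) ω‖ := rfl

namespace Network.IsModel

variable {Ω : Type*} [MeasurableSpace Ω] {P : Measure Ω} {N : Network Ω} {p : Params}

lemma measurable_served (hN : N.IsModel p P) : Measurable N.served := by
  have h := Stations.measurable_nearest hN.ms.measurable_all MeasurableSet.univ
  simpa [served] using! h

lemma measurable_servedDist (hN : N.IsModel p P) : Measurable N.servedDist := by
  rw [N.servedDist_eq]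
  exact hN.ms.measurable_nearestDist MeasurableSet.univ

lemma measurable_iPhi (hN : N.IsModel p P) : Measurable (N.iPhi p) :=
  Stations.measurable_interference hN.ms.measurable_all _ _ hN.measurable_served

lemma measurableSet_transmits :
    MeasurableSet {z : Plane × (Bool × ℝ) | z.2.1 = true} :=
  (measurable_fst.comp measurable_snd) (measurableSet_singleton true)

lemma measurable_iPsi (hN : N.IsModel p P) : Measurable (N.iPsi p) :=
  Stations.measurable_interference hN.bs.measurable_all _ _
    (Stations.measurable_nearest hN.bs.measurable_all measurableSet_transmits)

theorem laplace_iPsi [IsProbabilityMeasure P] (hN : N.IsModel p P) {r : ℝ} (hr : 0 < r) :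
    laplace (P.map (N.iPsi p)) (p.s r) = p.lPsi r := by
  have h := hN.bs.lintegral_interference (σ := fun _ => p.s r) (φ := fun _ => 1)
    p.lamC_pos.le p.μ_pos measurableSet_transmits (fun _ h => h)
    (by rw [p.lamC_mul_probD]; exact p.lamD_pos)
    (fun c hc => stationIntensity_transmits_disk p.lamC_pos.le _ p.μ_pos hc) p.PB_pos.le p.α
    continuous_const monotoneOn_const (fun _ _ => p.s_nonneg hr.le) measurable_const
  rw [p.lPsi_eq hr, ← h, laplace, lintegral_map (by fun_prop) hN.measurable_iPsi]
  simp only [one_mul]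
  rfl

lemma map_servedDist [IsProbabilityMeasure P] (hN : N.IsModel p P) :
    P.map N.servedDist = (volume.restrict (Ioi 0)).withDensity p.servedPDF := by
  rw [N.servedDist_eq]
  exact hN.ms.map_nearestDist p.μ_pos MeasurableSet.univ p.lamC_pos
    fun _ hc => stationIntensity_disk p.lamC_pos.le _ p.μ_pos hc

/-- The joint transform of the distance of the served mobile station and of the interference from
the other ones. -/
theorem lintegral_iPhi [IsProbabilityMeasure P] (hN : N.IsModel p P)
    {φ : ℝ → ℝ≥0∞} (hφ : Measurable φ) :
    ∫⁻ ω, φ (N.servedDist ω) *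
        expNeg (ENNReal.ofReal (p.s (N.servedDist ω)) * N.iPhi p ω) ∂P =
      ∫⁻ t in Ioi (0 : ℝ), p.servedPDF t * (φ t * p.lPhi t) := by
  have h := hN.ms.lintegral_interference (σ := p.s) (φ := φ)
    p.lamC_pos.le p.μ_pos MeasurableSet.univ (fun _ _ => mem_univ _) p.lamC_pos
    (fun c hc => stationIntensity_disk p.lamC_pos.le _ p.μ_pos hc) p.PM_pos.le p.α
    p.continuous_s p.monotoneOn_s (fun _ => p.s_nonneg) hφ
  refine Eq.trans h (setLIntegral_congr_fun measurableSet_Ioi fun t ht => ?_)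
  simp only [Params.servedPDF, p.lPhi_eq ht]

lemma ae_servedDist_pos [IsProbabilityMeasure P] (hN : N.IsModel p P) :
    ∀ᵐ ω ∂P, 0 < N.servedDist ω := by
  have h : ∀ᵐ t ∂(P.map N.servedDist), 0 < t := by
    rw [hN.map_servedDist]
    exact (withDensity_absolutelyContinuous _ _).ae_le (ae_restrict_mem measurableSet_Ioi)
  exact ae_of_ae_map hN.measurable_servedDist.aemeasurable h

/-- The conditional Laplace transform is identified by integrating it over sets of distances; the
served distance has a positive density, so that a property holding almost surely for it holds almost
everywhere. -/
theorem laplace_condDistrib_iPhi [IsProbabilityMeasure P] (hN : N.IsModel p P) :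
    ∀ᵐ r ∂(volume.restrict (Ioi (0 : ℝ))),
      laplace (condDistrib (N.iPhi p) N.servedDist P r) (p.s r) = p.lPhi r := by
  have hR := hN.measurable_servedDist
  have hs := p.continuous_s.measurable
  have hfm := p.measurable_servedPDF
  have hLm := measurable_laplace (κ := condDistrib (N.iPhi p) N.servedDist P) hs
  have hset : ∀ B, MeasurableSet B → volume.restrict (Ioi (0 : ℝ)) B < ∞ →
      ∫⁻ r in B, p.servedPDF r * laplace (condDistrib (N.iPhi p) N.servedDist P r) (p.s r)
          ∂(volume.restrict (Ioi 0)) =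
        ∫⁻ r in B, p.servedPDF r * p.lPhi r ∂(volume.restrict (Ioi 0)) := fun B hB _ => by
    set φ : ℝ → ℝ≥0∞ := B.indicator 1 with hφ
    have hφm : Measurable φ := measurable_one.indicator hB
    have hind : ∀ F : ℝ → ℝ≥0∞, ∫⁻ r in B, p.servedPDF r * F r ∂(volume.restrict (Ioi 0)) =
        ∫⁻ r in Ioi 0, p.servedPDF r * (φ r * F r) := fun F => by
      rw [← lintegral_indicator hB]
      refine lintegral_congr fun r => ?_
      by_cases hr : r ∈ B <;> simp [hφ, hr]
    have hF : Measurable fun v : ℝ × ℝ≥0∞ => φ v.1 * expNeg (ENNReal.ofReal (p.s v.1) * v.2) := by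
      fun_prop
    rw [hind, hind, ← hN.lintegral_iPhi hφm,
      ← lintegral_map hF (hR.prodMk hN.measurable_iPhi),
      ← compProd_map_condDistrib hN.measurable_iPhi.aemeasurable, Measure.lintegral_compProd hF,
      hN.map_servedDist, lintegral_withDensity_eq_lintegral_mul _ hfm
        (hF.lintegral_kernel_prod_right')]
    refine lintegral_congr fun r => ?_
    simp only [Pi.mul_apply]
    rw [lintegral_const_mul _ (by fun_prop), laplace]
  have hae := ae_eq_of_forall_setLIntegral_eq_of_sigmaFinite (hfm.mul hLm)
    (hfm.mul p.measurable_lPhi) hset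
  filter_upwards [hae, ae_restrict_mem measurableSet_Ioi] with r hr hr0
  have hr0 : 0 < r := hr0
  have hpos : p.servedPDF r ≠ 0 := by
    have := Real.pi_pos; have := p.lamC_pos
    unfold Params.servedPDF
    exact (ENNReal.ofReal_pos.2 (by positivity)).ne'
  exact (ENNReal.mul_right_inj hpos ENNReal.ofReal_ne_top).1 hr

lemma map_gain (hN : N.IsModel p P) (k : ℕ) : P.map (N.ms.gain k) = expMeasure p.μ := by
  have := isProbabilityMeasure_expMeasure p.μ_pos
  have h : P.map (N.ms.gain k) = (P.map (N.ms.mark k)).map Prod.snd :=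
    (Measure.map_map measurable_snd (hN.ms.measurable_mark k)).symm
  rw [h, (hN.ms.law_mark k).map_eq]
  exact Measure.snd_prod

lemma measurable_gain (hN : N.IsModel p P) (k : ℕ) : Measurable (N.ms.gain k) :=
  measurable_snd.comp (hN.ms.measurable_mark k)

lemma ae_gain_pos [IsProbabilityMeasure P] (hN : N.IsModel p P) (k : ℕ) :
    ∀ᵐ ω ∂P, 0 < N.ms.gain k ω := by
  have := isProbabilityMeasure_expMeasure p.μ_pos
  have h : ∀ᵐ y ∂(P.map (N.ms.gain k)), 0 < y := by
    have hcdf := cdf_expMeasure_eq p.μ_pos 0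
    rw [cdf_eq_real, if_pos le_rfl, mul_zero, neg_zero, Real.exp_zero, sub_self,
      measureReal_eq_zero_iff] at hcdf
    rw [hN.map_gain, ae_iff]
    refine measure_mono_null (fun y hy => ?_) hcdf
    simpa using hy
  exact ae_of_ae_map (hN.measurable_gain k).aemeasurable h

/-- The fading of mobile station `k` is independent of all other randomness. -/
lemma indepFun_gain [IsProbabilityMeasure P] (hN : N.IsModel p P) (k : ℕ) :
    IndepFun (fun ω => (eraseMark k (N.ms.all ω), N.bs.all ω)) (N.ms.gain k) P := by
  have hmk := hN.ms.measurable_mark k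
  have hms := hN.ms.measurable_all
  have hbs := hN.bs.measurable_all
  have hpos : Measurable fun ω n => N.ms.pos n ω := measurable_pi_lambda _ hN.ms.poisson.measurable
  have hite : Measurable fun (m : ℕ → Bool × ℝ) n => if n = k then (false, (0 : ℝ)) else m n :=
    measurable_pi_lambda _ fun n => by
      by_cases hn : n = k
      · simp only [hn, if_true]
        exact measurable_const
      · simp only [hn, if_false]
        exact measurable_pi_apply n
  have hmarks : Measurable fun ω n => if n = k then (false, (0 : ℝ)) else N.ms.mark n ω :=
    hite.comp (measurable_pi_lambda _ hN.ms.measurable_mark)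
  have h1 : IndepFun (N.ms.mark k)
      (fun ω => ((fun n => if n = k then (false, (0 : ℝ)) else N.ms.mark n ω),
        fun n => N.ms.pos n ω)) P := by
    refine IndepFun.prodMk_right_of_prodMk_left
      (hN.ms.indep_mark.indepFun_ite hN.ms.measurable_mark k (false, 0)) ?_ hmk hmarks hpos
    exact hN.ms.indep_pos_mark.symm.comp (φ := fun m : ℕ → Bool × ℝ =>
      (m k, fun n => if n = k then (false, (0 : ℝ)) else m n))
      ((measurable_pi_apply k).prodMk hite) measurable_id
  have hall : Measurable fun z : ℕ → Plane × (Bool × ℝ) => ((z k).2,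
      ((fun n => if n = k then (false, (0 : ℝ)) else (z n).2), fun n => (z n).1)) := by
    refine (by fun_prop : Measurable fun z : ℕ → Plane × (Bool × ℝ) => (z k).2).prodMk
      ((hite.comp (?_ : Measurable fun (z : ℕ → Plane × (Bool × ℝ)) n => (z n).2)).prodMk ?_)
    · fun_prop
    · fun_prop
  have h2 := IndepFun.prodMk_right_of_prodMk_left h1
    (hN.indep.symm.comp hall measurable_id) hmk (hmarks.prodMk hpos) hbs
  exact (h2.comp measurable_snd (ψ := fun v => ((fun n => (v.1.2 n, v.1.1 n)), v.2))
    (by fun_prop)).symm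

end Network.IsModel

/-! ### Success probability -/

lemma measurable_nearest_univ : Measurable fun z => coordStations.nearest univ z := by
  simpa using! Stations.measurable_nearest measurable_all_coordStations MeasurableSet.univ

lemma measurable_norm_pos_nearest :
    Measurable fun z => ‖coordStations.pos (coordStations.nearest univ z) z‖ := by
  have h : Measurable fun x : ℕ × (ℕ → Plane × (Bool × ℝ)) => ‖coordStations.pos x.1 x.2‖ :=
    measurable_from_prod_countable_right fun n =>
      (Stations.measurable_pos measurable_all_coordStations n).norm
  exact Measurable.comp (f := fun z => (coordStations.nearest univ z, z)) h
    (measurable_nearest_univ.prodMk measurable_id')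

lemma measurable_interference_paired (pw α : ℝ) :
    Measurable fun z => coordStations.interference pw α
      (coordStations.nearest {n | coordStations.transmits n z = true} z) z :=
  Stations.measurable_interference measurable_all_coordStations _ _
    (Stations.measurable_nearest measurable_all_coordStations
      Network.IsModel.measurableSet_transmits)

namespace Network

/-- The interference and noise at the typical base station, as a function of the random fields,
when mobile station `k` is the served one. -/
def noiseFrom (p : Params) (k : ℕ) (v : (ℕ → Plane × (Bool × ℝ)) × (ℕ → Plane × (Bool × ℝ))) :
    ℝ≥0∞ :=
  coordStations.interference p.PB p.α
      (coordStations.nearest {n | coordStations.transmits n v.2 = true} v.2) v.2 +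
    coordStations.interference p.PM p.α k v.1 + ENNReal.ofReal (p.σ ^ 2)

lemma measurable_noiseFrom (p : Params) (k : ℕ) : Measurable (noiseFrom p k) := by
  have h2 : Measurable fun z => coordStations.interference p.PM p.α k z :=
    Stations.measurable_interference measurable_all_coordStations _ _ measurable_const
  exact (((measurable_interference_paired _ _).comp measurable_snd).add
    (h2.comp measurable_fst)).add measurable_const

lemma noiseFrom_of_served_eq {Ω : Type*} {N : Network Ω} {p : Params} {k : ℕ} {ω : Ω}
    (hk : N.served ω = k) :
    noiseFrom p k (eraseMark k (N.ms.all ω), N.bs.all ω) =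
      N.iPsi p ω + N.iPhi p ω + ENNReal.ofReal (p.σ ^ 2) := by
  simp only [noiseFrom, interference_eraseMark]
  subst hk
  rfl

namespace IsModel

variable {Ω : Type*} [MeasurableSpace Ω] {P : Measure Ω} {N : Network Ω} {p : Params}

/-- The SINR condition as a threshold for the fading gain `g`; `D` is interference plus noise and
may be `0` or `∞`. -/
lemma le_sinr_iff {d g : ℝ} (hd : 0 < d) (hg : 0 < g) (p : Params) (D : ℝ≥0∞) :
    ENNReal.ofReal p.β ≤ ENNReal.ofReal (g * d ^ (-p.α) * p.PM) / D ↔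
      ENNReal.ofReal p.β * D / ENNReal.ofReal (d ^ (-p.α) * p.PM) ≤ ENNReal.ofReal g := by
  have hPM := p.PM_pos
  have hpos : 0 < d ^ (-p.α) * p.PM := by positivity
  have hpos' : 0 < g * d ^ (-p.α) * p.PM := by positivity
  rw [ENNReal.le_div_iff_mul_le (.inr (ENNReal.ofReal_pos.2 hpos').ne')
      (.inr ENNReal.ofReal_ne_top),
    ENNReal.div_le_iff (ENNReal.ofReal_pos.2 hpos).ne' ENNReal.ofReal_ne_top,
    ← ENNReal.ofReal_mul hg.le, mul_assoc]

lemma ofReal_mul_threshold {d : ℝ} (hd : 0 < d) (p : Params) (D : ℝ≥0∞) :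
    ENNReal.ofReal p.μ * (ENNReal.ofReal p.β * D / ENNReal.ofReal (d ^ (-p.α) * p.PM)) =
      ENNReal.ofReal (p.s d) * D := by
  have hPM := p.PM_pos; have hμ := p.μ_pos; have hβ := p.β_pos
  have hpos : 0 < d ^ (-p.α) * p.PM := by positivity
  have hs : p.s d = p.μ * p.β * (d ^ (-p.α) * p.PM)⁻¹ := by
    rw [Params.s, Real.rpow_neg hd.le]
    field_simp
  rw [hs, ENNReal.ofReal_mul (mul_nonneg hμ.le hβ.le), ENNReal.ofReal_mul hμ.le,
    ENNReal.ofReal_inv_of_pos hpos, div_eq_mul_inv]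
  ring

variable [IsProbabilityMeasure P]

/-- Averaging over the fading of the served station turns the event `β ≤ sinr` into a Laplace
transform. As the index of the served station is random, the event is split according to it. -/
theorem measure_le_sinr (hN : N.IsModel p P) :
    P {ω | ENNReal.ofReal p.β ≤ N.sinr p ω} =
      ∫⁻ ω, expNeg (ENNReal.ofReal (p.s (N.servedDist ω)) *
        (N.iPsi p ω + N.iPhi p ω + ENNReal.ofReal (p.σ ^ 2))) ∂P := by
  have hbs := hN.bs.measurable_all
  have hms := hN.ms.measurable_all
  have hkm : ∀ k, MeasurableSet {ω | N.served ω = k} := fun k =>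
    hN.measurable_served (measurableSet_singleton k)
  have hU : (univ : Set Ω) = ⋃ k, {ω | N.served ω = k} := by
    ext ω; simp
  have hdisj : Pairwise fun i j => Disjoint {ω | N.served ω = i} {ω | N.served ω = j} :=
    fun i j hij => Set.disjoint_left.2 fun ω h1 h2 => hij
      ((show N.served ω = i from h1).symm.trans h2)
  set E := {ω | ENNReal.ofReal p.β ≤ N.sinr p ω} with hE
  rw [← Measure.restrict_apply_univ E, ← setLIntegral_univ, hU, measure_iUnion hdisj hkm,
    lintegral_iUnion hkm hdisj]
  refine tsum_congr fun k => ?_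
  rw [Measure.restrict_apply (hkm k)]
  set V : Ω → (ℕ → Plane × (Bool × ℝ)) × (ℕ → Plane × (Bool × ℝ)) :=
    fun ω => (eraseMark k (N.ms.all ω), N.bs.all ω) with hV
  have hem : Measurable (eraseMark k) := by
    refine measurable_pi_lambda _ fun n => ?_
    unfold eraseMark
    by_cases hn : n = k
    · simp only [hn, if_true]
      fun_prop
    · simp only [hn, if_false]
      fun_prop
  have hVm : Measurable V := (hem.comp hms).prodMk hbs
  set B : Set ((ℕ → Plane × (Bool × ℝ)) × (ℕ → Plane × (Bool × ℝ))) :=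
    {v | coordStations.nearest univ v.1 = k} with hB
  have hBm : MeasurableSet B := by
    exact (measurable_nearest_univ.comp measurable_fst) (measurableSet_singleton k)
  set c : (ℕ → Plane × (Bool × ℝ)) × (ℕ → Plane × (Bool × ℝ)) → ℝ≥0∞ := fun v =>
    ENNReal.ofReal p.β * noiseFrom p k v / ENNReal.ofReal (‖(v.1 k).1‖ ^ (-p.α) * p.PM) with hc
  have hcm : Measurable c := by
    have h1 := measurable_noiseFrom p k
    have h2 : Measurable fun v : (ℕ → Plane × (Bool × ℝ)) × (ℕ → Plane × (Bool × ℝ)) =>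
        ENNReal.ofReal (‖(v.1 k).1‖ ^ (-p.α) * p.PM) := by fun_prop
    exact (h1.const_mul _).div h2
  have hVB : {ω | V ω ∈ B} = {ω | N.served ω = k} := rfl
  have hmain := measure_le_ofReal_of_indepFun (hN.indepFun_gain k) hVm (hN.measurable_gain k)
    p.μ_pos (hN.map_gain k) hBm hcm
  have hdist : ∀ ω, N.served ω = k → N.servedDist ω = ‖((V ω).1 k).1‖ := fun ω hω => by
    subst hω
    rfl
  refine Eq.trans (measure_congr ?_) (hmain.trans (hVB ▸ lintegral_congr_ae ?_))
  · filter_upwards [hN.ae_servedDist_pos, hN.ae_gain_pos k] with ω hR hg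
    refine propext (and_congr_right fun hω => ?_)
    have hω : N.served ω = k := hω
    have hD := noiseFrom_of_served_eq (p := p) hω
    have hsinr : N.sinr p ω = ENNReal.ofReal (N.ms.gain k ω * N.servedDist ω ^ (-p.α) * p.PM) /
        (N.iPsi p ω + N.iPhi p ω + ENNReal.ofReal (p.σ ^ 2)) := by
      subst hω
      rfl
    change ENNReal.ofReal p.β ≤ N.sinr p ω ↔ ENNReal.ofReal p.β * noiseFrom p k (V ω) /
      ENNReal.ofReal (‖((V ω).1 k).1‖ ^ (-p.α) * p.PM) ≤ ENNReal.ofReal (N.ms.gain k ω)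
    rw [hD, ← hdist ω hω, hsinr, le_sinr_iff hR hg]
  · filter_upwards [ae_restrict_of_ae hN.ae_servedDist_pos, ae_restrict_mem (hkm k)] with ω hR hω
    have hω : N.served ω = k := hω
    rw [← noiseFrom_of_served_eq (p := p) hω, ← ofReal_mul_threshold hR, hdist ω hω]

/-- The base stations are integrated out first, then the mobile ones. -/
theorem success_probability (hN : N.IsModel p P) :
    P {ω | ENNReal.ofReal p.β ≤ N.sinr p ω} =
      ENNReal.ofReal (2 * Real.pi * p.lamC) * ∫⁻ r in Ioi (0 : ℝ),
        ENNReal.ofReal (r * Real.exp (-Real.pi * p.lamC * r ^ 2 - p.s r * p.σ ^ 2)) *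
          p.lPsi r * p.lPhi r := by
  have hs := p.continuous_s.measurable
  have hφm : Measurable fun t => laplace (P.map (N.iPsi p)) (p.s t) :=
    measurable_laplace (κ := Kernel.const ℝ (P.map (N.iPsi p))) hs
  have hind : IndepFun (fun ω => (N.servedDist ω, N.iPhi p ω)) (N.iPsi p) P := by
    exact hN.indep.symm.comp
      (φ := fun z => (‖coordStations.pos (coordStations.nearest univ z) z‖,
        coordStations.interference p.PM p.α (coordStations.nearest univ z) z))
      (ψ := fun z => coordStations.interference p.PB p.α
        (coordStations.nearest {n | coordStations.transmits n z = true} z) z)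
      (measurable_norm_pos_nearest.prodMk (Stations.measurable_interference
        measurable_all_coordStations _ _ measurable_nearest_univ))
      (measurable_interference_paired _ _)
  have hF : Measurable fun v : (ℝ × ℝ≥0∞) × ℝ≥0∞ => expNeg (ENNReal.ofReal (p.s v.1.1) *
      (v.2 + v.1.2 + ENNReal.ofReal (p.σ ^ 2))) := by fun_prop
  rw [hN.measure_le_sinr]
  refine (lintegral_indepFun hind (hN.measurable_servedDist.prodMk hN.measurable_iPhi)
    hN.measurable_iPsi hF).trans ?_
  have hstep : ∀ ω, ∫⁻ y, expNeg (ENNReal.ofReal (p.s (N.servedDist ω)) *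
        (y + N.iPhi p ω + ENNReal.ofReal (p.σ ^ 2))) ∂(P.map (N.iPsi p)) =
      (laplace (P.map (N.iPsi p)) (p.s (N.servedDist ω)) *
          expNeg (ENNReal.ofReal (p.s (N.servedDist ω)) * ENNReal.ofReal (p.σ ^ 2))) *
        expNeg (ENNReal.ofReal (p.s (N.servedDist ω)) * N.iPhi p ω) := fun ω => by
    simp_rw [mul_add, expNeg_add]
    rw [lintegral_mul_const _ (by fun_prop), lintegral_mul_const _ (by fun_prop), laplace]
    ring
  simp only [hstep]
  rw [hN.lintegral_iPhi (φ := fun t => laplace (P.map (N.iPsi p)) (p.s t) *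
    expNeg (ENNReal.ofReal (p.s t) * ENNReal.ofReal (p.σ ^ 2))) (by fun_prop),
    ← lintegral_const_mul' _ _ ENNReal.ofReal_ne_top]
  refine setLIntegral_congr_fun measurableSet_Ioi fun t ht => ?_
  have ht : 0 < t := ht
  have hst := p.s_nonneg ht.le
  have hpi := Real.pi_pos; have hlam := p.lamC_pos
  have hexp : p.servedPDF t * ENNReal.ofReal (Real.exp (-(p.s t * p.σ ^ 2))) =
      ENNReal.ofReal (2 * Real.pi * p.lamC) *
        ENNReal.ofReal (t * Real.exp (-Real.pi * p.lamC * t ^ 2 - p.s t * p.σ ^ 2)) := by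
    rw [Params.servedPDF, ← ENNReal.ofReal_mul (by positivity),
      ← ENNReal.ofReal_mul (by positivity),
      sub_eq_add_neg, Real.exp_add]
    congr 1
    ring
  rw [hN.laplace_iPsi ht, ← ENNReal.ofReal_mul hst, expNeg_ofReal (by positivity)]
  calc _ = p.servedPDF t * ENNReal.ofReal (Real.exp (-(p.s t * p.σ ^ 2))) *
        p.lPsi t * p.lPhi t := by ring
    _ = _ := by rw [hexp]; ring

end IsModel

end Network

end CoMPflex
end

theorem theorem1 {Ω : Type*} [MeasurableSpace Ω] (P : Measure Ω) [IsProbabilityMeasure P]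
    (p : CoMPflex.Params) (N : CoMPflex.Network Ω) (hN : N.IsModel p P) :
    (∀ r : ℝ, 0 < r → CoMPflex.laplace (P.map (N.iPsi p)) (p.s r) = p.lPsi r) ∧
    (∀ᵐ r ∂(volume.restrict (Ioi (0 : ℝ))),
      CoMPflex.laplace (condDistrib (N.iPhi p) N.servedDist P r) (p.s r) = p.lPhi r) ∧
    P {ω | ENNReal.ofReal p.β ≤ N.sinr p ω} =
      ENNReal.ofReal (2 * Real.pi * p.lamC) * ∫⁻ r in Ioi (0 : ℝ),
        ENNReal.ofReal (r * Real.exp (-Real.pi * p.lamC * r ^ 2 - p.s r * p.σ ^ 2)) *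
          p.lPsi r * p.lPhi r :=
  ⟨fun _ hr => hN.laplace_iPsi hr, hN.laplace_condDistrib_iPhi, hN.success_probability⟩
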